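/- Let $\mathbb O=\mathbb R^8$ be the octonions with canonical basis $e_0,\dots,e_7$, realised as pairs of quaternions ($e_0,\dots,e_3$ being $1,i,j,k$ in the first component and $e_4,\dots,e_7$ those in the second) with product $(a,b)(c,d)=(ac-d^*b,\;da+bc^*)$. Let $G_2=\mathrm{Aut}(\mathbb O)$, and let $V_2(\mathbb R^7)$ be the $11$-dimensional Stiefel manifold of orthonormal $2$-frames in $\mathbb R^7=\operatorname{Im}\mathbb O$, on which $G_2$ acts transitively by $\varphi\cdot(a,b)=(\varphi a,\varphi b)$. For $0\le i<j\le 7$ let $E_{ij}\in\mathfrak{so}(8)$ be the matrix (rows and columns numbered from $0$ to $7$) with $(i,j)$ entry $-1$, $(j,i)$ entry $1$ and all other entries $0$, and put \begin{align*} X_3&=-\tfrac{\sqrt3}6(2E_{23}-E_{45}+E_{67}), & X_4&=\tfrac{\sqrt3}6(2E_{13}+E_{46}+E_{57}), & X_5&=-\tfrac{\sqrt3}6(2E_{12}-E_{47}+E_{56}),\\ X_6&=-\tfrac12(E_{17}-E_{24}), & X_7&=\tfrac12(E_{16}+E_{25}), & X_8&=-\tfrac12(E_{15}-E_{26}),\\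 X_9&=\tfrac12(E_{14}+E_{27}), & X_{10}&=\tfrac{\sqrt3}6(E_{16}-E_{25}+2E_{34}), & X_{11}&=\tfrac{\sqrt3}6(E_{17}+E_{24}+2E_{35}),\\ X_{12}&=-\tfrac{\sqrt3}6(E_{14}-E_{27}-2E_{36}), & X_{13}&=-\tfrac{\sqrt3}6(E_{15}+E_{26}-2E_{37}). && \end{align*} These span a complement $\mathfrak m\subset\mathfrak g_2\subset\mathfrak{so}(8)$ of the isotropy algebra of the frame $p=(e_1,e_2)$, so $X\mapsto X\cdot p=(Xe_1,Xe_2)$ identifies $\mathfrak m$ with $T_pV_2(\mathbb R^7)$. For $r>0$ let $g_r$ be the $G_2$-invariant Riemannian metric on $V_2(\mathbb R^7)$ given at $p$, in terms of the dual basis $X^3,\dots,X^{13}$, by $$g_r=\tfrac13\,(X^3\otimes X^3+X^4\otimes X^4)+r\,X^5\otimes X^5+\tfrac12\sum_{i=6}^{9}X^i\otimes X^i+\tfrac16\sum_{i=10}^{13}X^i\otimes X^i .$$ The following hold. 1. For every $r>0$, the metric $g_r$ has non-negative sectional curvature if and only if $r\le\frac49$. 2. For every $r>0$, the plane of $T_pV_2(\mathbb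 R^7)$ spanned by $X_3\cdot p$ and $X_4\cdot p$ has sectional curvature $1-\frac94r$ with respect to $g_r$. 3. Let $Y_i=X_i/\sqrt{g_r(X_i,X_i)}$ and let $F_r(x,y)=g_r(R^{g_r}(X,Y)Y,X)$ be the curvature quartic at $p$, where $X=\sum_{i=3}^{13}x_{i-3}Y_i$, $Y=\sum_{i=3}^{13}y_{i-3}Y_i$ and $R(X,Y)=[\nabla_X,\nabla_Y]-\nabla_{[X,Y]}$. Then $F_r$ is a polynomial in $(x,y)\in\mathbb R^{11}\times\mathbb R^{11}$ whose dependence on $r$ is affine: there are polynomials $P,Q\in\mathbb R[x_0,\dots,x_{10},y_0,\dots,y_{10}]$ with $F_r=P+rQ$ for all $r>0$. Moreover $F_0:=P$ and $F_{4/9}=P+\frac49Q$ are sums of squares of real polynomials. -/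

import Mathlib

open scoped ContDiff Quaternion Matrix

noncomputable section

namespace RiemannianCoords

/-! Riemannian geometry in coordinates.  A metric on an open subset of `ℝⁿ` is given by its Gram
matrix `h x i j`; all objects below are the classical coordinate expressions. -/

variable {n : ℕ}

/-- The partial derivative `∂ᵢ f` at `x`. -/
def pd (i : Fin n) (f : (Fin n → ℝ) → ℝ) (x : Fin n → ℝ) : ℝ :=
  fderiv ℝ f x (Pi.single i 1)

/-- The Christoffel symbol `Γᵏᵢⱼ = ½ ∑ₗ hᵏˡ (∂ᵢ hⱼₗ + ∂ⱼ hᵢₗ - ∂ₗ hᵢⱼ)`. -/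
def christoffel (h : (Fin n → ℝ) → Matrix (Fin n) (Fin n) ℝ) (k i j : Fin n)
    (x : Fin n → ℝ) : ℝ :=
  (1 / 2) * ∑ l, (h x)⁻¹ k l *
    (pd i (fun y => h y j l) x + pd j (fun y => h y i l) x - pd l (fun y => h y i j) x)

/-- The curvature tensor of the Levi-Civita connection: `R(∂ᵢ, ∂ⱼ) ∂ₖ = ∑ₗ Rˡᵢⱼₖ ∂ₗ`, where
`R(U, V) = ∇_U ∇_V - ∇_V ∇_U - ∇_[U, V]`. -/
def riemann (h : (Fin n → ℝ) → Matrix (Fin n) (Fin n) ℝ) (l i j k : Fin n)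
    (x : Fin n → ℝ) : ℝ :=
  pd i (christoffel h l j k) x - pd j (christoffel h l i k) x
    + ∑ m, (christoffel h l i m x * christoffel h m j k x
      - christoffel h l j m x * christoffel h m i k x)

/-- The curvature quartic `h(R(u, v) v, u)` at `x`. -/
def curvQuartic (h : (Fin n → ℝ) → Matrix (Fin n) (Fin n) ℝ) (x u v : Fin n → ℝ) : ℝ :=
  ∑ i, ∑ j, ∑ k, ∑ l, ∑ p, u i * v j * v k * u p * (h x p l * riemann h l i j k x)

variable {F : Type*} [NormedAddCommGroup F] [NormedSpace ℝ F]

/-- `ψ : U → M` is a regular smooth local parametrization, defined on an open set `U ⊆ ℝⁿ`, of the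
`n`-dimensional submanifold `M` of the vector space `F`. -/
structure IsLocalParam (M : Set F) (U : Set (Fin n → ℝ)) (ψ : (Fin n → ℝ) → F) : Prop where
  isOpen : IsOpen U
  smooth : ContDiffOn ℝ ∞ ψ U
  immersion : ∀ x ∈ U, Function.Injective (fderiv ℝ ψ x)
  injOn : Set.InjOn ψ U
  mapsTo : Set.MapsTo ψ U M

/-- The Gram matrix, in the coordinates given by `ψ`, of a field `g` of bilinear forms. -/
def pullback (g : F → F → F → ℝ) (ψ : (Fin n → ℝ) → F) (x : Fin n → ℝ) :
    Matrix (Fin n) (Fin n) ℝ :=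
  Matrix.of fun i j =>
    g (ψ x) (fderiv ℝ ψ x (Pi.single i 1)) (fderiv ℝ ψ x (Pi.single j 1))

/-- `V` is tangent at `q` to the `n`-dimensional submanifold `M`. -/
def IsTangent (n : ℕ) (M : Set F) (q V : F) : Prop :=
  ∃ (U : Set (Fin n → ℝ)) (ψ : (Fin n → ℝ) → F), IsLocalParam M U ψ ∧
    ∃ x ∈ U, ψ x = q ∧ ∃ u, fderiv ℝ ψ x u = V

/-- The curvature quartic `g(R(V, W) W, V)` of the Riemannian metric `g` on the `n`-dimensional
submanifold `M`, for `V, W` tangent at `q`: its value, which is the same in all local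
parametrizations around `q`, in one of them. -/
def curv (n : ℕ) (M : Set F) (g : F → F → F → ℝ) (q V W : F) : ℝ :=
  Classical.epsilon fun t : ℝ =>
    ∃ (U : Set (Fin n → ℝ)) (ψ : (Fin n → ℝ) → F), IsLocalParam M U ψ ∧
      ∃ x ∈ U, ψ x = q ∧ ∃ u v, fderiv ℝ ψ x u = V ∧ fderiv ℝ ψ x v = W ∧
        t = curvQuartic (pullback g ψ) x u v

/-- The sectional curvature at `q` of the plane spanned by the tangent vectors `V, W`. -/
def sectionalCurvature (n : ℕ) (M : Set F) (g : F → F → F → ℝ) (q V W : F) : ℝ :=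
  curv n M g q V W / (g q V V * g q W W - g q V W ^ 2)

/-- All sectional curvatures of `(M, g)` are non-negative. -/
def NonnegSectionalCurvature (n : ℕ) (M : Set F) (g : F → F → F → ℝ) : Prop :=
  ∀ q ∈ M, ∀ V W : F, IsTangent n M q V → IsTangent n M q W →
    LinearIndependent ℝ ![V, W] → 0 ≤ sectionalCurvature n M g q V W

end RiemannianCoords

namespace StiefelG2

/-- The octonions as a vector space, with coordinates in the canonical basis `e₀, …, e₇`. -/
abbrev Oct : Type := Fin 8 → ℝ

/-- The canonical basis. -/
def e (i : Fin 8) : Oct := Pi.single i 1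

/-- The quaternion `a + b i + c j + d k`. -/
def quat (a b c d : ℝ) : ℍ[ℝ] := ⟨a, b, c, d⟩

theorem quat_re (a b c d : ℝ) : (quat a b c d).re = a := rfl

theorem quat_imI (a b c d : ℝ) : (quat a b c d).imI = b := rfl

theorem quat_imJ (a b c d : ℝ) : (quat a b c d).imJ = c := rfl

theorem quat_imK (a b c d : ℝ) : (quat a b c d).imK = d := rfl

/-- The octonion product `(a, b)(c, d) = (ac - d* b, da + bc*)` on pairs of quaternions. -/
def octMul (x y : Oct) : Oct :=
  let a := quat (x 0) (x 1) (x 2) (x 3)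
  let b := quat (x 4) (x 5) (x 6) (x 7)
  let c := quat (y 0) (y 1) (y 2) (y 3)
  let d := quat (y 4) (y 5) (y 6) (y 7)
  let p := a * c - star d * b
  let q := d * a + b * star c
  ![p.re, p.imI, p.imJ, p.imK, q.re, q.imI, q.imJ, q.imK]

/-- The automorphism group `G₂` of the octonions. -/
def G2 : Subgroup (Oct ≃ₗ[ℝ] Oct) where
  carrier := {φ | ∀ x y, φ (octMul x y) = octMul (φ x) (φ y)}
  mul_mem' := by
    intro φ ψ hφ hψ x y
    simp only [Set.mem_ofPred_eq, LinearEquiv.mul_apply] at *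
    rw [hψ, hφ]
  one_mem' := by
    intro x y
    rfl
  inv_mem' := by
    intro φ hφ x y
    apply φ.injective
    simp only [Set.mem_ofPred_eq] at hφ
    rw [hφ]
    simp

/-- The Stiefel manifold of orthonormal 2-frames in `ℝ⁷`, the space of imaginary octonions. -/
def stiefel : Set (Oct × Oct) :=
  {q | q.1 0 = 0 ∧ q.2 0 = 0 ∧ q.1 ⬝ᵥ q.1 = 1 ∧ q.2 ⬝ᵥ q.2 = 1 ∧ q.1 ⬝ᵥ q.2 = 0}

/-- The matrix `E i j ∈ 𝔰𝔬(8)` with entry `-1` at `(i, j)` and entry `1` at `(j, i)`. -/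
def E (i j : Fin 8) : Matrix (Fin 8) (Fin 8) ℝ :=
  Matrix.single j i 1 - Matrix.single i j 1

/-- The basis `X₃, …, X₁₃` of the reductive complement `𝔪` in `𝔤₂ ⊆ 𝔰𝔬(8)`; `mBasis i` is
`X_{i + 3}`. -/
def mBasis : Fin 11 → Matrix (Fin 8) (Fin 8) ℝ :=
  ![-(√3 / 6) • ((2 : ℝ) • E 2 3 - E 4 5 + E 6 7),
    (√3 / 6) • ((2 : ℝ) • E 1 3 + E 4 6 + E 5 7),
    -(√3 / 6) • ((2 : ℝ) • E 1 2 - E 4 7 + E 5 6),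
    -(1 / 2 : ℝ) • (E 1 7 - E 2 4),
    (1 / 2 : ℝ) • (E 1 6 + E 2 5),
    -(1 / 2 : ℝ) • (E 1 5 - E 2 6),
    (1 / 2 : ℝ) • (E 1 4 + E 2 7),
    (√3 / 6) • (E 1 6 - E 2 5 + (2 : ℝ) • E 3 4),
    (√3 / 6) • (E 1 7 + E 2 4 + (2 : ℝ) • E 3 5),
    -(√3 / 6) • (E 1 4 - E 2 7 - (2 : ℝ) • E 3 6),
    -(√3 / 6) • (E 1 5 + E 2 6 - (2 : ℝ) • E 3 7)]

/-- The base point `(e₁, e₂)` of the Stiefel manifold. -/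
def basePoint : Oct × Oct := (e 1, e 2)

/-- The tangent vector `X · (e₁, e₂)` at the base point, for `X = ∑ᵢ cᵢ X_{i + 3} ∈ 𝔪`. -/
def baseVec (c : Fin 11 → ℝ) : Oct × Oct :=
  ((∑ i, c i • mBasis i) *ᵥ e 1, (∑ i, c i • mBasis i) *ᵥ e 2)

/-- The coefficients of the diagonal inner product `g_r` on `𝔪` in the basis `X₃, …, X₁₃`. -/
def weight (r : ℝ) : Fin 11 → ℝ :=
  ![1 / 3, 1 / 3, r, 1 / 2, 1 / 2, 1 / 2, 1 / 2, 1 / 6, 1 / 6, 1 / 6, 1 / 6]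

/-- The `G₂`-invariant metric `g_r` on the Stiefel manifold: at the point `φ · (e₁, e₂)`, with
`φ ∈ G₂`, the product of the images under `φ` of the tangent vectors at the base point that
correspond to `c, d ∈ 𝔪` is `∑ᵢ weightᵢ cᵢ dᵢ`. -/
def metric (r : ℝ) (q v w : Oct × Oct) : ℝ :=
  Classical.epsilon fun t : ℝ =>
    ∃ φ ∈ G2, ∃ c d : Fin 11 → ℝ,
      q = (φ basePoint.1, φ basePoint.2) ∧
      v = (φ (baseVec c).1, φ (baseVec c).2) ∧
      w = (φ (baseVec d).1, φ (baseVec d).2) ∧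
      t = ∑ i, weight r i * c i * d i

/-- Coordinates on `𝔪` in the `g_r`-orthonormal basis `Yᵢ = Xᵢ / √(g_r(Xᵢ, Xᵢ))`, `3 ≤ i ≤ 13`. -/
def orthoCoords (r : ℝ) (x : Fin 11 → ℝ) : Fin 11 → ℝ :=
  fun i => x i / √(weight r i)

/-! The metric is well defined: automorphisms of the octonions preserve the dot product of
imaginary octonions, so the value of `metric` does not depend on the choice of `φ`. -/

theorem baseVec_eq (c : Fin 11 → ℝ) :
    baseVec c =
      (![0, 0, -(√3 / 3) * c 2, (√3 / 3) * c 1, c 6 / 2 - (√3 / 6) * c 9,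
          -(c 5 / 2) - (√3 / 6) * c 10, c 4 / 2 + (√3 / 6) * c 7,
          -(c 3 / 2) + (√3 / 6) * c 8],
       ![0, (√3 / 3) * c 2, 0, -(√3 / 3) * c 0, c 3 / 2 + (√3 / 6) * c 8,
          c 4 / 2 - (√3 / 6) * c 7, c 5 / 2 - (√3 / 6) * c 10,
          c 6 / 2 + (√3 / 6) * c 9]) := by
  unfold baseVec e
  simp only [Matrix.mulVec_single_one, Fin.sum_univ_succ, mBasis, E, Finset.univ_eq_empty,
    Finset.sum_empty]
  ext i <;> fin_cases i <;>
    simp <;> ring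

theorem octMul_eq (x y : Oct) :
    octMul x y =
      ![x 0 * y 0 - x 1 * y 1 - x 2 * y 2 - x 3 * y 3
          - x 4 * y 4 - x 5 * y 5 - x 6 * y 6 - x 7 * y 7,
        x 0 * y 1 + x 1 * y 0 + x 2 * y 3 - x 3 * y 2
          - y 4 * x 5 + y 5 * x 4 + y 6 * x 7 - y 7 * x 6,
        x 0 * y 2 - x 1 * y 3 + x 2 * y 0 + x 3 * y 1
          - y 4 * x 6 - y 5 * x 7 + y 6 * x 4 + y 7 * x 5,
        x 0 * y 3 + x 1 * y 2 - x 2 * y 1 + x 3 * y 0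
          - y 4 * x 7 + y 5 * x 6 - y 6 * x 5 + y 7 * x 4,
        y 4 * x 0 - y 5 * x 1 - y 6 * x 2 - y 7 * x 3
          + x 4 * y 0 + x 5 * y 1 + x 6 * y 2 + x 7 * y 3,
        y 4 * x 1 + y 5 * x 0 + y 6 * x 3 - y 7 * x 2
          - x 4 * y 1 + x 5 * y 0 - x 6 * y 3 + x 7 * y 2,
        y 4 * x 2 - y 5 * x 3 + y 6 * x 0 + y 7 * x 1
          - x 4 * y 2 + x 5 * y 3 + x 6 * y 0 - x 7 * y 1,
        y 4 * x 3 + y 5 * x 2 - y 6 * x 1 + y 7 * x 0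
          - x 4 * y 3 - x 5 * y 2 + x 6 * y 1 + x 7 * y 0] := by
  ext i
  fin_cases i <;>
    simp [octMul, quat_re, quat_imI, quat_imJ, quat_imK] <;> ring

theorem octMul_self (x : Oct) (h : x 0 = 0) : octMul x x = (-(x ⬝ᵥ x)) • e 0 := by
  ext i
  fin_cases i <;> 
    simp [octMul_eq, e, dotProduct, Fin.sum_univ_succ, h] <;>
    ring

theorem octMul_one (x : Oct) : octMul x (e 0) = x := by
  ext i
  fin_cases i <;>
    simp [octMul_eq, e]

theorem one_octMul (x : Oct) : octMul (e 0) x = x := by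
  ext i
  fin_cases i <;>
    simp [octMul_eq, e]

theorem map_one_of_mem {φ : Oct ≃ₗ[ℝ] Oct} (hφ : φ ∈ G2) : φ (e 0) = e 0 := by
  have h := hφ (φ.symm (e 0)) (e 0)
  rw [octMul_one, φ.apply_symm_apply, one_octMul] at h
  exact h.symm

theorem dot_self_of_mem {φ : Oct ≃ₗ[ℝ] Oct} (hφ : φ ∈ G2) (x : Oct) (h : x 0 = 0) :
    φ x ⬝ᵥ φ x = x ⬝ᵥ x := by
  have h1 := hφ x x
  rw [octMul_self x h, map_smul, map_one_of_mem hφ] at h1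
  have hx : 0 ≤ x ⬝ᵥ x := Finset.sum_nonneg fun i _ => mul_self_nonneg _
  generalize φ x = y at h1
  generalize x ⬝ᵥ x = s at h1 hx
  have k : ∀ i, (-s) • e 0 i = octMul y y i := fun i => by rw [← h1]; rfl
  have k0 := k 0
  have k1 := k 1
  have k2 := k 2
  have k3 := k 3
  have k4 := k 4
  have k5 := k 5
  have k6 := k 6
  have k7 := k 7
  simp [octMul_eq, e]
    at k0 k1 k2 k3 k4 k5 k6 k7
  simp only [dotProduct, Fin.sum_univ_succ]
  simp
  have hy : y 0 = 0 := by
    by_contra hne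
    have z1 : y 1 = 0 := by
      have : y 0 * y 1 = 0 := by linarith
      simpa [hne] using this
    have z2 : y 2 = 0 := by
      have : y 0 * y 2 = 0 := by linarith
      simpa [hne] using this
    have z3 : y 3 = 0 := by
      have : y 0 * y 3 = 0 := by linarith
      simpa [hne] using this
    have z4 : y 4 = 0 := by
      have : y 0 * y 4 = 0 := by linarith
      simpa [hne] using this
    have z5 : y 5 = 0 := by
      have : y 0 * y 5 = 0 := by linarith
      simpa [hne] using this
    have z6 : y 6 = 0 := by
      have : y 0 * y 6 = 0 := by linarith
      simpa [hne] using this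
    have z7 : y 7 = 0 := by
      have : y 0 * y 7 = 0 := by linarith
      simpa [hne] using this
    rw [z1, z2, z3, z4, z5, z6, z7] at k0
    have : 0 < y 0 * y 0 := mul_self_pos.mpr hne
    linarith
  rw [hy] at k0 ⊢
  linarith

theorem dot_of_mem {φ : Oct ≃ₗ[ℝ] Oct} (hφ : φ ∈ G2) (x y : Oct) (hx : x 0 = 0) (hy : y 0 = 0) :
    φ x ⬝ᵥ φ y = x ⬝ᵥ y := by
  have h := dot_self_of_mem hφ (x + y) (by simp [hx, hy])
  have h1 := dot_self_of_mem hφ x hx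
  have h2 := dot_self_of_mem hφ y hy
  simp only [map_add, add_dotProduct, dotProduct_add] at h
  rw [dotProduct_comm (φ y) (φ x), dotProduct_comm y x] at h
  linarith

theorem weight_sum (r : ℝ) {φ : Oct ≃ₗ[ℝ] Oct} (hφ : φ ∈ G2) (c d : Fin 11 → ℝ) :
    ∑ i, weight r i * c i * d i =
      φ (baseVec c).1 ⬝ᵥ φ (baseVec d).1 + φ (baseVec c).2 ⬝ᵥ φ (baseVec d).2 +
        (3 * r - 2) * (φ (baseVec c).1 ⬝ᵥ φ basePoint.2) *
          (φ (baseVec d).1 ⬝ᵥ φ basePoint.2) := by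
  have h3 : √3 * √3 = 3 := Real.mul_self_sqrt (by norm_num)
  have hc1 : (baseVec c).1 0 = 0 := by simp [baseVec_eq]
  have hd1 : (baseVec d).1 0 = 0 := by simp [baseVec_eq]
  have hc2 : (baseVec c).2 0 = 0 := by simp [baseVec_eq]
  have hd2 : (baseVec d).2 0 = 0 := by simp [baseVec_eq]
  have hb : basePoint.2 0 = 0 := by simp [basePoint, e]
  rw [dot_of_mem hφ _ _ hc1 hd1, dot_of_mem hφ _ _ hc2 hd2, dot_of_mem hφ _ _ hc1 hb,
    dot_of_mem hφ _ _ hd1 hb, baseVec_eq, baseVec_eq]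
  simp [dotProduct, Fin.sum_univ_succ, weight, basePoint, e]
  ring_nf
  have h4 : √3 ^ 2 = 3 := by rw [sq, h3]
  simp only [h4]
  ring

theorem metric_apply (r : ℝ) (φ : Oct ≃ₗ[ℝ] Oct) (hφ : φ ∈ G2) (c d : Fin 11 → ℝ) :
    metric r (φ basePoint.1, φ basePoint.2) (φ (baseVec c).1, φ (baseVec c).2)
      (φ (baseVec d).1, φ (baseVec d).2) = ∑ i, weight r i * c i * d i := by
  obtain ⟨ψ, hψ, c', d', hq, hv, hw, ht⟩ := Classical.epsilon_spec
    (p := fun t : ℝ => ∃ ψ ∈ G2, ∃ c' d' : Fin 11 → ℝ,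
      (φ basePoint.1, φ basePoint.2) = (ψ basePoint.1, ψ basePoint.2) ∧
      (φ (baseVec c).1, φ (baseVec c).2) = (ψ (baseVec c').1, ψ (baseVec c').2) ∧
      (φ (baseVec d).1, φ (baseVec d).2) = (ψ (baseVec d').1, ψ (baseVec d').2) ∧
      t = ∑ i, weight r i * c' i * d' i)
    ⟨_, φ, hφ, c, d, rfl, rfl, rfl, rfl⟩
  unfold metric
  rw [ht, weight_sum r hψ, weight_sum r hφ]
  simp only [Prod.mk.injEq] at hq hv hw
  rw [hq.2, hv.1, hv.2, hw.1, hw.2]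

end StiefelG2

end

/-! ### The Gauss equation in coordinates. -/

namespace RiemannianCoords

variable {n : ℕ} {E : Type*} [NormedAddCommGroup E] [NormedSpace ℝ E]

/-! The curvature is computed extrinsically. Since `G2` acts transitively on orthonormal imaginary
2-frames (`exists_mem_G2`) and preserves the dot product of imaginary octonions, the metric has the
closed form `V.1 ⬝ᵥ W.1 + V.2 ⬝ᵥ W.2 + (3r - 2) fib V fib W` on tangent vectors at every frame
(`metric_eq`). Here `fib` is the component along the circles that rotate a frame in its plane. These
circles collapse under `(a, b) ↦ a ∧ b`, while horizontal vectors keep their length. Hence `(a, b) ↦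
(a, b, a ∧ b)` induces `g_r` from a constant bilinear form, with weight `ρ = 3r/2` on the frame and
`1 - ρ` on the bivector (`ambientForm_push`). The form is indefinite for `r > 2/3`, but the Gauss
equation needs only symmetry of the form and nondegeneracy of the induced metric
(`curvQuartic_eq_of_isometric`).

With the explicit second fundamental form `sff`, the Gauss equation yields `quartic`
(`ambientForm_sff`, `curv_eq`). For horizontal parts `(v₁, v₂)`, `(w₁, w₂)` and fibre components
`t`, `s`, the quartic is `|v₁ ∧ w₁ + v₂ ∧ w₂|² + (1 - 9r/4)(v₁·w₂ - v₂·w₁)² + (9r²/4)(|t w₁ - s v₁|²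
+ |t w₂ - s v₂|²)`. This agrees with O'Neill's picture for the circle bundle over the oriented
Grassmannian: the first two terms at `r = 0` are the curvature of the base.

All terms are non-negative when `r ≤ 4/9`. The plane of `X₃`, `X₄` isolates the middle term, so its
curvature `1 - 9r/4` makes the bound sharp. In `g_r`-orthonormal coordinates the horizontal parts do
not involve `r`, and a fibre component is a coordinate times a constant whose square is `1/(3r)`.
The last term therefore becomes linear in `r`, and the sums of squares at `r = 0` and `r = 4/9` can
be read off. -/

theorem pd_congr {i : Fin n} {f g : (Fin n → ℝ) → ℝ} {x : Fin n → ℝ} {U : Set (Fin n → ℝ)}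
    (hU : IsOpen U) (hx : x ∈ U) (h : ∀ y ∈ U, f y = g y) : pd i f x = pd i g x := by
  have : f =ᶠ[nhds x] g := Filter.eventually_of_mem (hU.mem_nhds hx) h
  rw [pd, pd, this.fderiv_eq]

theorem fderiv_apply_const {G H : Type*} [NormedAddCommGroup G] [NormedSpace ℝ G]
    [NormedAddCommGroup H] [NormedSpace ℝ H] {c : G → H →L[ℝ] E} {x : G}
    (hc : DifferentiableAt ℝ c x) (u : H) (v : G) :
    fderiv ℝ (fun y => c y u) x v = fderiv ℝ c x v u := by
  rw [fderiv_clm_apply hc (differentiableAt_const _)]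
  simp

theorem fderiv_bilinear {G H K : Type*} [NormedAddCommGroup G] [NormedSpace ℝ G]
    [NormedAddCommGroup H] [NormedSpace ℝ H] [NormedAddCommGroup K] [NormedSpace ℝ K]
    (B : E →L[ℝ] H →L[ℝ] K) {f : G → E} {g : G → H} {x : G} (hf : DifferentiableAt ℝ f x)
    (hg : DifferentiableAt ℝ g x) (v : G) :
    fderiv ℝ (fun y => B (f y) (g y)) x v =
      B (fderiv ℝ f x v) (g x) + B (f x) (fderiv ℝ g x v) := by
  rw [B.fderiv_of_bilinear hf hg]
  simp [add_comm]

theorem differentiableAt_det {m : Type*} [Fintype m] [DecidableEq m] {G : Type*}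
    [NormedAddCommGroup G] [NormedSpace ℝ G] {h : G → Matrix m m ℝ} {x : G}
    (hh : ∀ i j, DifferentiableAt ℝ (fun y => h y i j) x) :
    DifferentiableAt ℝ (fun y => (h y).det) x := by
  have h1 : ∀ σ : Equiv.Perm m, DifferentiableAt ℝ (fun y => ∏ i, h y (σ i) i) x := fun σ => by
    classical
    exact (HasFDerivAt.finsetProd fun i _ => (hh (σ i) i).hasFDerivAt).differentiableAt
  simp only [Matrix.det_apply]
  exact DifferentiableAt.fun_sum fun σ _ => (h1 σ).const_smul _

/-- Needed only so that the Christoffel symbols can be differentiated; the derivative of the inverse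
matrix is never computed. -/
theorem differentiableAt_inv {m : Type*} [Fintype m] [DecidableEq m] {G : Type*}
    [NormedAddCommGroup G] [NormedSpace ℝ G] {h : G → Matrix m m ℝ} {x : G}
    (hh : ∀ i j, DifferentiableAt ℝ (fun y => h y i j) x) (hd : (h x).det ≠ 0) (i j : m) :
    DifferentiableAt ℝ (fun y => (h y)⁻¹ i j) x := by
  simp only [Matrix.inv_def, Ring.inverse_eq_inv', Matrix.smul_apply, Matrix.adjugate_apply,
    smul_eq_mul]
  refine ((differentiableAt_det hh).inv hd).mul (differentiableAt_det fun k l => ?_)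
  by_cases hk : k = j
  · subst hk
    simp
  · simpa [Matrix.updateRow_ne hk] using hh k l

/-- The Gauss equation, in coordinates: the metric `h` is induced by `Φ` from a constant symmetric
bilinear form `B`, and `Nuu`, `Nuv`, `Nvv` are the `B`-normal parts of the second derivatives. -/
theorem curvQuartic_eq_of_isometric (B : E →L[ℝ] E →L[ℝ] ℝ) (hB : ∀ a b, B a b = B b a)
    {U : Set (Fin n → ℝ)} (hU : IsOpen U) {Φ : (Fin n → ℝ) → E} (hΦ : ContDiffOn ℝ ∞ Φ U)
    {h : (Fin n → ℝ) → Matrix (Fin n) (Fin n) ℝ}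
    (hh : ∀ x ∈ U, ∀ i j,
      h x i j = B (fderiv ℝ Φ x (Pi.single i 1)) (fderiv ℝ Φ x (Pi.single j 1)))
    (hdet : ∀ x ∈ U, (h x).det ≠ 0) {x : Fin n → ℝ} (hx : x ∈ U) (u v : Fin n → ℝ)
    {Nuu Nuv Nvv : E} {wuu wuv wvv : Fin n → ℝ}
    (huu : fderiv ℝ (fderiv ℝ Φ) x u u = Nuu + fderiv ℝ Φ x wuu)
    (huv : fderiv ℝ (fderiv ℝ Φ) x u v = Nuv + fderiv ℝ Φ x wuv)
    (hvv : fderiv ℝ (fderiv ℝ Φ) x v v = Nvv + fderiv ℝ Φ x wvv)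
    (nuu : ∀ w, B Nuu (fderiv ℝ Φ x w) = 0) (nuv : ∀ w, B Nuv (fderiv ℝ Φ x w) = 0) :

    curvQuartic h x u v = B Nuu Nvv - B Nuv Nuv := by
  set D := fderiv ℝ Φ with hD
  set D2 := fderiv ℝ D with hD2
  have cD : ContDiffOn ℝ ∞ D U := hΦ.fderiv_of_isOpen hU (by simp)
  have cD2 : ContDiffOn ℝ ∞ D2 U := cD.fderiv_of_isOpen hU (by simp)
  have dD : ∀ y ∈ U, DifferentiableAt ℝ D y := fun y hy =>
    (cD.differentiableOn (by simp)).differentiableAt (hU.mem_nhds hy)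
  have dD2 : ∀ y ∈ U, DifferentiableAt ℝ D2 y := fun y hy =>
    (cD2.differentiableOn (by simp)).differentiableAt (hU.mem_nhds hy)
  have two_le : minSmoothness ℝ 2 ≤ (∞ : WithTop ℕ∞) := by
    rw [minSmoothness_of_isRCLikeNormedField]
    exact WithTop.coe_le_coe.mpr le_top
  have sD2 : ∀ y ∈ U, ∀ a b, D2 y a b = D2 y b a := fun y hy a b =>
    ((hΦ.contDiffAt (hU.mem_nhds hy)).isSymmSndFDerivAt two_le) a b
  have sD3 : ∀ a b, fderiv ℝ D2 x a b = fderiv ℝ D2 x b a := fun a b =>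
    ((cD.contDiffAt (hU.mem_nhds hx)).isSymmSndFDerivAt two_le) a b
  set e : Fin n → Fin n → ℝ := fun i => Pi.single i 1 with he
  have dh : ∀ y ∈ U, ∀ i j, DifferentiableAt ℝ (fun z => h z i j) y := by
    intro y hy i j
    have : DifferentiableAt ℝ (fun z => B (D z (e i)) (D z (e j))) y := by
      have := dD y hy
      fun_prop
    exact this.congr_of_eventuallyEq (Filter.eventually_of_mem (hU.mem_nhds hy) fun z hz =>
      hh z hz i j)
  have pdh : ∀ y ∈ U, ∀ k i j, pd k (fun z => h z i j) y =
      B (D2 y (e k) (e i)) (D y (e j)) + B (D y (e i)) (D2 y (e k) (e j)) := by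
    intro y hy k i j
    rw [pd_congr hU hy (fun z hz => hh z hz i j), pd, fderiv_bilinear B
      ((dD y hy).clm_apply (differentiableAt_const _))
      ((dD y hy).clm_apply (differentiableAt_const _)), fderiv_apply_const (dD y hy),
      fderiv_apply_const (dD y hy)]
  -- In the Koszul formula for an induced metric, symmetry of the second derivative cancels all but
  -- one pair of terms.
  have chr : ∀ y ∈ U, ∀ k i j, christoffel h k i j y =
      ∑ l, (h y)⁻¹ k l * B (D2 y (e i) (e j)) (D y (e l)) := by
    intro y hy k i j
    rw [christoffel, Finset.mul_sum]
    refine Finset.sum_congr rfl fun l _ => ?_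
    rw [pdh y hy, pdh y hy, pdh y hy, sD2 y hy (e j) (e i), sD2 y hy (e l) (e i),
      sD2 y hy (e l) (e j), hB (D y (e j)), hB (D y (e i)) (D2 y (e j) (e l))]
    ring
  have dchr : ∀ k i j, DifferentiableAt ℝ (christoffel h k i j) x := by
    intro k i j
    have : DifferentiableAt ℝ
        (fun y => ∑ l, (h y)⁻¹ k l * B (D2 y (e i) (e j)) (D y (e l))) x := by
      refine DifferentiableAt.fun_sum fun l _ => ?_
      refine (differentiableAt_inv (dh x hx) (hdet x hx) k l).mul ?_
      have := dD x hx
      have := dD2 x hx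
      fun_prop
    exact this.congr_of_eventuallyEq (Filter.eventually_of_mem (hU.mem_nhds hx) fun z hz =>
      chr z hz k i j)
  have low : ∀ y ∈ U, ∀ p i j, ∑ k, h y p k * christoffel h k i j y =
      B (D2 y (e i) (e j)) (D y (e p)) := by
    intro y hy p i j
    have h1 : (fun k => christoffel h k i j y) =
        (h y)⁻¹ *ᵥ fun l => B (D2 y (e i) (e j)) (D y (e l)) := by
      ext k
      rw [chr y hy]
      rfl
    have h2 : h y *ᵥ (fun k => christoffel h k i j y) =
        fun l => B (D2 y (e i) (e j)) (D y (e l)) := by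
      rw [h1, Matrix.mulVec_mulVec, Matrix.mul_nonsing_inv _ (hdet y hy).isUnit,
        Matrix.one_mulVec]
    exact congrFun h2 p
  -- Differentiating the lowered identity `low` gives the derivative of the Christoffel symbols
  -- without differentiating the inverse Gram matrix.
  have dlow : ∀ p i j k, ∑ l, h x p l * pd i (christoffel h l j k) x =
      B (fderiv ℝ D2 x (e i) (e j) (e k)) (D x (e p)) + B (D2 x (e j) (e k)) (D2 x (e i) (e p))
        - ∑ l, (B (D2 x (e i) (e p)) (D x (e l)) + B (D x (e p)) (D2 x (e i) (e l))) *
          christoffel h l j k x := by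
    intro p i j k
    have h1 : pd i (fun y => ∑ l, h y p l * christoffel h l j k y) x =
        ∑ l, (h x p l * pd i (christoffel h l j k) x +
          pd i (fun z => h z p l) x * christoffel h l j k x) := by
      rw [pd, fderiv_fun_sum fun l _ => (dh x hx p l).fun_mul (dchr l j k)]
      rw [sum_apply]
      refine Finset.sum_congr rfl fun l _ => ?_
      rw [fderiv_fun_mul (dh x hx p l) (dchr l j k)]
      simp [pd, mul_comm]
    have h2 : pd i (fun y => ∑ l, h y p l * christoffel h l j k y) x =
        B (fderiv ℝ D2 x (e i) (e j) (e k)) (D x (e p)) +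
          B (D2 x (e j) (e k)) (D2 x (e i) (e p)) := by
      rw [pd_congr hU hx (fun y hy => low y hy p j k), pd, fderiv_bilinear B
        (((dD2 x hx).clm_apply (differentiableAt_const _)).clm_apply (differentiableAt_const _))
        ((dD x hx).clm_apply (differentiableAt_const _)), fderiv_apply_const (dD x hx),
        fderiv_apply_const ((dD2 x hx).clm_apply (differentiableAt_const _)),
        fderiv_apply_const (dD2 x hx)]
    rw [← h2, h1, Finset.sum_add_distrib, add_sub_assoc, left_eq_add, sub_eq_zero]
    exact Finset.sum_congr rfl fun l _ => by rw [pdh x hx]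
  set T : Fin n → Fin n → Fin n → ℝ := fun j k l => christoffel h l j k x with hT
  have DT : ∀ j k, D x (T j k) = ∑ l, T j k l • D x (e l) := by
    intro j k
    conv_lhs => rw [pi_eq_sum_univ' (T j k)]
    simp [he]
  -- `S j k` is the normal part of the second derivative: the Christoffel symbols are the
  -- coordinates of its tangential part.
  set S : Fin n → Fin n → E := fun j k => D2 x (e j) (e k) - D x (T j k) with hS
  -- The third derivatives cancel by symmetry. The products of Christoffel symbols cancel one half
  -- of the derivative of the metric, and the other half completes second derivatives to `S`.
  have hriem : ∀ p i j k, ∑ l, h x p l * riemann h l i j k x =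
      B (D2 x (e i) (e p)) (S j k) - B (D2 x (e j) (e p)) (S i k) := by
    intro p i j k
    have h1 : ∀ i j, ∑ l, h x p l * ∑ m, christoffel h l i m x * christoffel h m j k x =
        ∑ m, B (D2 x (e i) (e m)) (D x (e p)) * christoffel h m j k x := by
      intro i j
      simp_rw [Finset.mul_sum]
      rw [Finset.sum_comm]
      refine Finset.sum_congr rfl fun m _ => ?_
      rw [← low x hx, Finset.sum_mul]
      exact Finset.sum_congr rfl fun l _ => by ring
    have h2 : ∀ i j, B (D2 x (e i) (e p)) (S j k) = B (D2 x (e j) (e k)) (D2 x (e i) (e p)) -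
        ∑ l, B (D2 x (e i) (e p)) (D x (e l)) * christoffel h l j k x := by
      intro i j
      rw [hS]
      simp only [map_sub, DT, map_sum, map_smul, smul_eq_mul]
      rw [hB (D2 x (e i) (e p))]
      congr 1
      exact Finset.sum_congr rfl fun l _ => mul_comm _ _
    simp only [riemann, mul_add, mul_sub, Finset.sum_add_distrib, Finset.sum_sub_distrib, dlow,
      h1, h2, add_mul, sD3 (e j) (e i), hB (D x (e p))]
    ring
  have nS : ∀ j k w, B (S j k) (D x w) = 0 := by
    intro j k w
    have h1 : ∀ p, B (S j k) (D x (e p)) = 0 := by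
      intro p
      rw [hS]
      simp only [map_sub, sub_apply, DT, map_sum, map_smul,
        sum_apply, smul_apply, smul_eq_mul]
      rw [← low x hx, sub_eq_zero]
      refine Finset.sum_congr rfl fun l _ => ?_
      rw [hh x hx, hB, mul_comm]
    rw [pi_eq_sum_univ' w]
    simp only [map_sum, map_smul]
    exact Finset.sum_eq_zero fun p _ => by rw [h1 p, smul_zero]
  have vec : ∀ w : Fin n → ℝ, w = ∑ i, w i • e i := fun w => pi_eq_sum_univ' w
  have key : curvQuartic h x u v =
      B (D2 x u u) (∑ j, ∑ k, (v j * v k) • S j k) -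
        B (D2 x u v) (∑ j, ∑ k, (u j * v k) • S j k) := by
    have h1 : ∀ a b c d : Fin n → ℝ, B (D2 x a b) (∑ j, ∑ k, (c j * d k) • S j k) =
        ∑ i, ∑ j, ∑ k, ∑ p, a i * c j * d k * b p * B (D2 x (e i) (e p)) (S j k) := by
      intro a b c d
      generalize hs : ∑ j, ∑ k, (c j * d k) • S j k = s
      have h2 : B (D2 x a b) s = ∑ i, ∑ p, a i * b p * B (D2 x (e i) (e p)) s := by
        conv_lhs => rw [vec a, vec b]
        simp only [map_sum, map_smul, sum_apply, smul_apply, smul_eq_mul, Finset.mul_sum,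
          mul_assoc]
        rw [Finset.sum_comm]
        exact Finset.sum_congr rfl fun i _ => Finset.sum_congr rfl fun p _ => by ring
      rw [h2]
      refine Finset.sum_congr rfl fun i _ => ?_
      subst hs
      simp only [map_sum, map_smul, smul_eq_mul, Finset.mul_sum]
      rw [Finset.sum_comm]
      refine Finset.sum_congr rfl fun j _ => ?_
      rw [Finset.sum_comm]
      exact Finset.sum_congr rfl fun k _ => Finset.sum_congr rfl fun p _ => by ring
    have h3 : curvQuartic h x u v = ∑ i, ∑ j, ∑ k, ∑ p, u i * v j * v k * u p *
        (B (D2 x (e i) (e p)) (S j k) - B (D2 x (e j) (e p)) (S i k)) := by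
      rw [curvQuartic]
      refine Finset.sum_congr rfl fun i _ => Finset.sum_congr rfl fun j _ =>
        Finset.sum_congr rfl fun k _ => ?_
      rw [Finset.sum_comm]
      refine Finset.sum_congr rfl fun p _ => ?_
      rw [← hriem, Finset.mul_sum]
    have h4 : B (D2 x u v) (∑ j, ∑ k, (u j * v k) • S j k) =
        ∑ i, ∑ j, ∑ k, ∑ p, u i * v j * v k * u p * B (D2 x (e j) (e p)) (S i k) := by
      rw [sD2 x hx, h1, Finset.sum_comm]
      exact Finset.sum_congr rfl fun i _ => Finset.sum_congr rfl fun j _ =>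
        Finset.sum_congr rfl fun k _ => Finset.sum_congr rfl fun p _ => by ring
    rw [h1, h4, h3]
    simp only [mul_sub, Finset.sum_sub_distrib]
  have hSv : ∀ a b : Fin n → ℝ, ∃ w, ∑ j, ∑ k, (a j * b k) • S j k = D2 x a b + D x w := by
    intro a b
    refine ⟨-∑ j, ∑ k, (a j * b k) • T j k, ?_⟩
    have h1 : D2 x a b = ∑ j, ∑ k, (a j * b k) • D2 x (e j) (e k) := by
      conv_lhs => rw [vec a, vec b]
      simp only [map_sum, map_smul, sum_apply, smul_apply, Finset.smul_sum, smul_smul]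
      rw [Finset.sum_comm]
      exact Finset.sum_congr rfl fun j _ => Finset.sum_congr rfl fun k _ => by rw [mul_comm]
    rw [h1]
    simp only [map_neg, map_sum, map_smul, hS, smul_sub, Finset.sum_sub_distrib]
    exact sub_eq_add_neg _ _
  have nSv : ∀ a b w : Fin n → ℝ, B (∑ j, ∑ k, (a j * b k) • S j k) (D x w) = 0 := by
    intro a b w
    simp [nS]
  -- Any decomposition into a normal and a tangential vector may replace `S`: tangential errors pair
  -- to zero with `S` on one side and with `N` on the other.
  have fin : ∀ (a b c d w w' : Fin n → ℝ) (N N' : E), D2 x a b = N + D x w →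
      D2 x c d = N' + D x w' → (∀ z, B N (D x z) = 0) →
      B (D2 x a b) (∑ j, ∑ k, (c j * d k) • S j k) = B N N' := by
    intro a b c d w w' N N' h1 h2 h3
    obtain ⟨z, hz⟩ := hSv c d
    rw [h1, map_add, add_apply, hB (D x w), nSv, hz, h2]
    simp [h3]
  rw [key, fin u u v v wuu wvv Nuu Nvv huu hvv nuu, fin u v u v wuv wuv Nuv Nuv huv huv nuv]

end RiemannianCoords

/-! ### Octonion identities and transitivity of `G2` on 2-frames. -/

namespace StiefelG2

theorem dot_eq (x y : Oct) : x ⬝ᵥ y = x 0 * y 0 + x 1 * y 1 + x 2 * y 2 + x 3 * y 3 + x 4 * y 4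
    + x 5 * y 5 + x 6 * y 6 + x 7 * y 7 := by
  simp [dotProduct, Fin.sum_univ_succ]
  ring

theorem octMul_add (x y z : Oct) : octMul x (y + z) = octMul x y + octMul x z := by
  ext i
  fin_cases i <;> simp [octMul_eq] <;> ring

theorem add_octMul (x y z : Oct) : octMul (x + y) z = octMul x z + octMul y z := by
  ext i
  fin_cases i <;> simp [octMul_eq] <;> ring

theorem octMul_smul (s : ℝ) (x y : Oct) : octMul x (s • y) = s • octMul x y := by
  ext i
  fin_cases i <;> simp [octMul_eq] <;> ring

theorem smul_octMul (s : ℝ) (x y : Oct) : octMul (s • x) y = s • octMul x y := by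
  ext i
  fin_cases i <;> simp [octMul_eq] <;> ring

theorem octMul_neg (x y : Oct) : octMul x (-y) = -octMul x y := by
  simpa using octMul_smul (-1) x y

theorem neg_octMul (x y : Oct) : octMul (-x) y = -octMul x y := by
  simpa using smul_octMul (-1) x y

theorem octMul_zero_coord (x y : Oct) (hx : x 0 = 0) : octMul x y 0 = -(x ⬝ᵥ y) := by
  simp only [dot_eq, octMul_eq]
  simp [hx]
  ring

theorem octMul_add_comm (x y : Oct) (hx : x 0 = 0) (hy : y 0 = 0) :
    octMul x y + octMul y x = (-2 * (x ⬝ᵥ y)) • e 0 := by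
  rw [dot_eq]
  ext i
  fin_cases i <;> simp [octMul_eq, hx, hy, e] <;> ring

theorem octMul_left_alt (x z y : Oct) (hx : x 0 = 0) (hz : z 0 = 0) :
    octMul x (octMul z y) + octMul z (octMul x y) = (-2 * (x ⬝ᵥ z)) • y := by
  rw [dot_eq]
  ext i
  fin_cases i <;> simp [octMul_eq, hx, hz] <;> ring

theorem octMul_right_alt (x z y : Oct) (hx : x 0 = 0) (hz : z 0 = 0) :
    octMul (octMul y x) z + octMul (octMul y z) x = (-2 * (x ⬝ᵥ z)) • y := by
  rw [dot_eq]
  ext i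
  fin_cases i <;> simp [octMul_eq, hx, hz] <;> ring

theorem dot_octMul_left (x y : Oct) (hy : y 0 = 0) : octMul x y ⬝ᵥ x = 0 := by
  simp only [dot_eq, octMul_eq]
  simp [hy]
  ring

theorem dot_octMul_right (x y : Oct) (hx : x 0 = 0) : octMul x y ⬝ᵥ y = 0 := by
  simp only [dot_eq, octMul_eq]
  simp [hx]
  ring

theorem dot_octMul_octMul (x y : Oct) :
    octMul x y ⬝ᵥ octMul x y = (x ⬝ᵥ x) * (y ⬝ᵥ y) := by
  simp only [dot_eq, octMul_eq]
  simp
  ring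

theorem dot_octMul_swap (x y z : Oct) (hx : x 0 = 0) :
    octMul x y ⬝ᵥ z = -(y ⬝ᵥ octMul x z) := by
  simp only [dot_eq, octMul_eq]
  simp [hx]
  ring

theorem octMul_self_unit {x : Oct} (hx : x 0 = 0) (h : x ⬝ᵥ x = 1) : octMul x x = -e 0 := by
  rw [octMul_self x hx, h, neg_one_smul]

theorem octMul_anticomm {x y : Oct} (hx : x 0 = 0) (hy : y 0 = 0) (h : x ⬝ᵥ y = 0) :
    octMul y x = -octMul x y := by
  have := octMul_add_comm x y hx hy
  rw [h, mul_zero, zero_smul] at this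
  exact (neg_eq_of_add_eq_zero_right this).symm

theorem octMul_octMul_self {x : Oct} (y : Oct) (hx : x 0 = 0) (h : x ⬝ᵥ x = 1) :
    octMul x (octMul x y) = -y := by
  have := octMul_left_alt x x y hx hx
  rw [h] at this
  ext i
  have := congrFun this i
  simp at this ⊢
  linarith

theorem octMul_self_octMul {x : Oct} (y : Oct) (hx : x 0 = 0) (h : x ⬝ᵥ x = 1) :
    octMul (octMul y x) x = -y := by
  have := octMul_right_alt x x y hx hx
  rw [h] at this
  ext i
  have := congrFun this i
  simp at this ⊢
  linarith

theorem octMul_left_swap {x z : Oct} (y : Oct) (hx : x 0 = 0) (hz : z 0 = 0) (h : x ⬝ᵥ z = 0) :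
    octMul x (octMul z y) = -octMul z (octMul x y) := by
  have := octMul_left_alt x z y hx hz
  rw [h, mul_zero, zero_smul] at this
  exact eq_neg_of_add_eq_zero_left this

theorem octMul_right_swap {x z : Oct} (y : Oct) (hx : x 0 = 0) (hz : z 0 = 0) (h : x ⬝ᵥ z = 0) :
    octMul (octMul y x) z = -octMul (octMul y z) x := by
  have := octMul_right_alt x z y hx hz
  rw [h, mul_zero, zero_smul] at this
  exact eq_neg_of_add_eq_zero_left this

/-- Orthonormal imaginary octonions `x`, `y`, whose product is orthogonal to a unit `c`. -/
structure IsTriple (x y c : Oct) : Prop where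
  x0 : x 0 = 0
  y0 : y 0 = 0
  c0 : c 0 = 0
  cc : c ⬝ᵥ c = 1
  xy : x ⬝ᵥ y = 0
  xc : x ⬝ᵥ c = 0
  yc : y ⬝ᵥ c = 0
  xyc : octMul x y ⬝ᵥ c = 0

namespace IsTriple

variable {x y c : Oct} (h : IsTriple x y c)
include h

theorem swap : IsTriple y x c where
  x0 := h.y0
  y0 := h.x0
  c0 := h.c0
  cc := h.cc
  xy := by rw [dotProduct_comm, h.xy]
  xc := h.yc
  yc := h.xc
  xyc := by rw [octMul_anticomm h.x0 h.y0 h.xy, neg_dotProduct, h.xyc, neg_zero]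

theorem octMul_zero : octMul x y 0 = 0 := by rw [octMul_zero_coord x y h.x0, h.xy, neg_zero]

/-- Anti-associativity across the Cayley-Dickson generator `c`: anticommute, exchange the two left
factors by the alternative law, then anticommute back. -/
theorem mul_mul : octMul x (octMul y c) = -octMul (octMul x y) c := by
  rw [← neg_neg (octMul y c), ← octMul_anticomm h.y0 h.c0 h.yc, octMul_neg,
    octMul_left_swap y h.x0 h.c0 h.xc, neg_neg,
    octMul_anticomm h.octMul_zero h.c0 h.xyc]

theorem mul_mul' : octMul (octMul y c) x = octMul (octMul x y) c := by
  have h1 : octMul y c 0 = 0 := by rw [octMul_zero_coord y c h.y0, h.yc, neg_zero]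
  have h2 : x ⬝ᵥ octMul y c = 0 := by
    have := dot_octMul_swap y x c h.y0
    rw [h.swap.xyc] at this
    linarith
  rw [octMul_anticomm h.x0 h1 h2, h.mul_mul, neg_neg]

theorem mul_mul_mul : octMul (octMul x c) (octMul y c) = -octMul x y := by
  have h1 : octMul y c 0 = 0 := by rw [octMul_zero_coord y c h.y0, h.yc, neg_zero]
  have h2 : c ⬝ᵥ octMul y c = 0 := by rw [dotProduct_comm, dot_octMul_right y c h.y0]
  rw [octMul_right_swap x h.c0 h1 h2, h.mul_mul, neg_octMul, neg_neg,
    octMul_self_octMul _ h.c0 h.cc]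

end IsTriple
-- Four linear conditions on eight coordinates have a non-zero solution. Applied to `1, a, b, ab`,
-- this supplies the third generator of a Cayley-Dickson basis.
theorem exists_unit_orthogonal (u : Fin 4 → Oct) :
    ∃ c : Oct, c ⬝ᵥ c = 1 ∧ ∀ i, u i ⬝ᵥ c = 0 := by
  have h1 : LinearMap.ker (Matrix.mulVecLin (Matrix.of u)) ≠ ⊥ :=
    LinearMap.ker_ne_bot_of_finrank_lt (by simp)
  obtain ⟨c, hc, hne⟩ := Submodule.exists_mem_ne_zero_of_ne_bot h1
  have hc' : ∀ i, u i ⬝ᵥ c = 0 := fun i => congrFun (LinearMap.mem_ker.mp hc) i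
  have hpos : 0 < c ⬝ᵥ c := by
    refine lt_of_le_of_ne (Finset.sum_nonneg fun i _ => mul_self_nonneg _) fun h => hne ?_
    exact dotProduct_self_eq_zero.mp h.symm
  refine ⟨(√(c ⬝ᵥ c))⁻¹ • c, ?_, fun i => by rw [dotProduct_smul, hc', smul_zero]⟩
  rw [smul_dotProduct, dotProduct_smul, smul_eq_mul, smul_eq_mul, ← mul_assoc, ← mul_inv,
    Real.mul_self_sqrt hpos.le, inv_mul_cancel₀ hpos.ne']

/-- The Cayley-Dickson basis generated by `a`, `b`, `c`. -/
noncomputable def frame (a b c : Oct) : Fin 8 → Oct :=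
  ![e 0, a, b, octMul a b, c, octMul a c, octMul b c, octMul (octMul a b) c]

theorem octMul_frame_sum (f : Fin 8 → Oct) (x y : Oct) :
    octMul (∑ i, x i • f i) (∑ j, y j • f j) =
      ∑ i, ∑ j, (x i * y j) • octMul (f i) (f j) := by
  have h1 : ∀ (s : Finset (Fin 8)) (z : Oct),
      octMul (∑ i ∈ s, x i • f i) z = ∑ i ∈ s, x i • octMul (f i) z := by
    intro s z
    induction s using Finset.induction_on with
    | empty => simpa using smul_octMul 0 0 z
    | insert i s hi ih => rw [Finset.sum_insert hi, Finset.sum_insert hi, add_octMul, ih,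
        smul_octMul]
  have h2 : ∀ (s : Finset (Fin 8)) (z : Oct),
      octMul z (∑ i ∈ s, y i • f i) = ∑ i ∈ s, y i • octMul z (f i) := by
    intro s z
    induction s using Finset.induction_on with
    | empty => simpa using octMul_smul 0 z 0
    | insert i s hi ih => rw [Finset.sum_insert hi, Finset.sum_insert hi, octMul_add, ih,
        octMul_smul]
  simp only [h1, h2, Finset.smul_sum, smul_smul]

/-- The linear map of `ℝ⁸` taking the canonical basis to `f`. -/
noncomputable def frameMap (f : Fin 8 → Oct) : Oct →ₗ[ℝ] Oct := Fintype.linearCombination ℝ f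

theorem frameMap_apply (f : Fin 8 → Oct) (x : Oct) : frameMap f x = ∑ i, x i • f i := rfl

theorem frameMap_e (f : Fin 8 → Oct) (i : Fin 8) : frameMap f (e i) = f i := by
  simp [frameMap_apply, e, Pi.single_apply]

/-- The multiplication table of the basis generated by `a, b, c` is forced by alternativity and the
orthogonality relations, so it coincides with that of the canonical basis. The products mixing `c`
with two different imaginary units are covered by the triples on `(a, b)`, `(a, ab)`, `(b, ab)` and
their swaps. -/
theorem frameMap_octMul {a b c : Oct} (h : IsTriple a b c) (ha : a ⬝ᵥ a = 1) (hb : b ⬝ᵥ b = 1)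
    (x y : Oct) : frameMap (frame a b c) (octMul x y) =
      octMul (frameMap (frame a b c) x) (frameMap (frame a b c) y) := by
  have d0 := h.octMul_zero
  have dd : octMul a b ⬝ᵥ octMul a b = 1 := by rw [dot_octMul_octMul, ha, hb, mul_one]
  have da : a ⬝ᵥ octMul a b = 0 := by rw [dotProduct_comm, dot_octMul_left a b h.y0]
  have db : b ⬝ᵥ octMul a b = 0 := by rw [dotProduct_comm, dot_octMul_right a b h.x0]
  have had : octMul a (octMul a b) = -b := octMul_octMul_self b h.x0 ha
  have hba : octMul b a = -octMul a b := octMul_anticomm h.x0 h.y0 h.xy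
  have hbd : octMul b (octMul a b) = a := by
    rw [← neg_neg (octMul a b), ← hba, octMul_neg, octMul_octMul_self a h.y0 hb, neg_neg]
  have hda : octMul (octMul a b) a = b := by rw [octMul_anticomm h.x0 d0 da, had, neg_neg]
  have hdb : octMul (octMul a b) b = -a := by rw [octMul_anticomm h.y0 d0 db, hbd]
  have tad : IsTriple a (octMul a b) c := ⟨h.x0, d0, h.c0, h.cc, da, h.xc, h.xyc, by
    rw [had, neg_dotProduct, h.yc, neg_zero]⟩
  have tbd : IsTriple b (octMul a b) c := ⟨h.y0, d0, h.c0, h.cc, db, h.yc, h.xyc, by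
    rw [hbd, h.xc]⟩
  -- The relations between `c` and a single unit `z`, to be used for `z = a`, `b` and `ab`.
  have caa : ∀ z : Oct, z 0 = 0 → z ⬝ᵥ c = 0 → z ⬝ᵥ z = 1 →
      octMul c z = -octMul z c ∧ octMul (octMul z c) z = c ∧ octMul c (octMul z c) = z ∧
        octMul (octMul z c) (octMul z c) = -e 0 := by
    intro z z0 zc zz
    have h1 := octMul_anticomm z0 h.c0 zc
    have h2 : octMul z c 0 = 0 := by rw [octMul_zero_coord z c z0, zc, neg_zero]
    have h3 : octMul c z = -octMul z c := h1
    refine ⟨h1, ?_, ?_, octMul_self_unit h2 (by rw [dot_octMul_octMul, zz, h.cc, mul_one])⟩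
    · rw [← neg_neg (octMul z c), ← h1, neg_octMul, octMul_self_octMul c z0 zz, neg_neg]
    · rw [← neg_neg (octMul z c), ← h1, octMul_neg, octMul_octMul_self z h.c0 h.cc, neg_neg]
  obtain ⟨ca, aca, cac, ac2⟩ := caa a h.x0 h.xc ha
  obtain ⟨cb, bcb, cbc, bc2⟩ := caa b h.y0 h.yc hb
  obtain ⟨cd, dcd, cdc, dc2⟩ := caa _ d0 h.xyc dd
  rw [frameMap_apply, frameMap_apply, frameMap_apply, octMul_frame_sum]
  simp only [Fin.sum_univ_eight, frame, Matrix.cons_val]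
  simp only [one_octMul, octMul_one, octMul_self_unit h.x0 ha, octMul_self_unit h.y0 hb,
    octMul_self_unit d0 dd, octMul_self_unit h.c0 h.cc, had, hba, hbd, hda, hdb, ca, aca, cac, ac2,
    cb, bcb, cbc, bc2, cd, dcd, cdc, dc2, octMul_octMul_self c h.x0 ha,
    octMul_octMul_self c h.y0 hb, octMul_octMul_self c d0 dd, octMul_self_octMul a h.c0 h.cc,
    octMul_self_octMul b h.c0 h.cc, octMul_self_octMul (octMul a b) h.c0 h.cc,
    h.mul_mul, h.mul_mul', h.mul_mul_mul, h.swap.mul_mul, h.swap.mul_mul', h.swap.mul_mul_mul,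
    tad.mul_mul, tad.mul_mul', tad.mul_mul_mul, tad.swap.mul_mul, tad.swap.mul_mul',
    tad.swap.mul_mul_mul, tbd.mul_mul, tbd.mul_mul', tbd.mul_mul_mul, tbd.swap.mul_mul,
    tbd.swap.mul_mul', tbd.swap.mul_mul_mul, neg_octMul, neg_neg, octMul_eq x y, Matrix.cons_val]
  module

theorem exists_mem_G2 {q : Oct × Oct} (hq : q ∈ stiefel) :
    ∃ φ ∈ G2, q = (φ basePoint.1, φ basePoint.2) := by
  obtain ⟨a, b⟩ := q
  obtain ⟨a0, b0, aa, bb, ab⟩ := hq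
  simp only at a0 b0 aa bb ab
  obtain ⟨c, cc, hc⟩ := exists_unit_orthogonal ![e 0, a, b, octMul a b]
  have c0 : c 0 = 0 := by simpa [e] using hc 0
  have h : IsTriple a b c := ⟨a0, b0, c0, cc, ab, hc 1, hc 2, hc 3⟩
  have hmul := frameMap_octMul h aa bb
  have hinj : Function.Injective (frameMap (frame a b c)) := by
    rw [← LinearMap.ker_eq_bot, LinearMap.ker_eq_bot']
    intro x hx
    -- `Function.update (-x) 0 (x 0)` is the conjugate of `x`. Since `x̄ x = |x|²`, a multiplicative
    -- map fixing `1` has trivial kernel.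
    have h1 : octMul (Function.update (-x) 0 (x 0)) x = (x ⬝ᵥ x) • e 0 := by
      rw [dot_eq]
      ext i
      fin_cases i <;> simp [octMul_eq, e] <;> ring
    have h2 := hmul (Function.update (-x) 0 (x 0)) x
    rw [h1, hx, map_smul, frameMap_e] at h2
    have h3 := octMul_smul 0 (frameMap (frame a b c) (Function.update (-x) 0 (x 0))) 0
    rw [zero_smul, zero_smul] at h3
    rw [h3] at h2
    have h4 := congrFun h2 0
    simp [frame, e] at h4
    exact h4
  refine ⟨LinearEquiv.ofInjectiveEndo _ hinj, hmul, ?_⟩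
  simp only [basePoint, LinearEquiv.coe_ofInjectiveEndo]
  rw [frameMap_e, frameMap_e]
  rfl

/-! ### Tangent spaces and a closed form of the metric. -/

/-- The tangent space at `q` of the Stiefel manifold. -/
def tangent (q : Oct × Oct) : Submodule ℝ (Oct × Oct) where
  carrier := {V | V.1 0 = 0 ∧ V.2 0 = 0 ∧ V.1 ⬝ᵥ q.1 = 0 ∧ V.2 ⬝ᵥ q.2 = 0 ∧
    V.1 ⬝ᵥ q.2 + V.2 ⬝ᵥ q.1 = 0}
  add_mem' := by
    rintro V W ⟨h1, h2, h3, h4, h5⟩ ⟨k1, k2, k3, k4, k5⟩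
    refine ⟨by simp [h1, k1], by simp [h2, k2], by simp [add_dotProduct, h3, k3],
      by simp [add_dotProduct, h4, k4], ?_⟩
    simp only [Prod.fst_add, Prod.snd_add, add_dotProduct]
    linarith
  zero_mem' := by simp
  smul_mem' := by
    rintro s V ⟨h1, h2, h3, h4, h5⟩
    refine ⟨by simp [h1], by simp [h2], by simp [smul_dotProduct, h3],
      by simp [smul_dotProduct, h4], ?_⟩
    simp only [Prod.smul_fst, Prod.smul_snd, smul_dotProduct, ← smul_add, h5, smul_zero]

/-- The square of `φ x` is a real multiple of `1`. If `φ x` had non-zero real part, its imaginary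
part would have to vanish, making `φ x` and hence `x` real; as `x` is imaginary, both would be zero.
-/
theorem coord_zero_of_mem {φ : Oct ≃ₗ[ℝ] Oct} (hφ : φ ∈ G2) {x : Oct} (h : x 0 = 0) :
    φ x 0 = 0 := by
  by_contra hne
  have h1 := hφ x x
  rw [octMul_self x h, map_smul, map_one_of_mem hφ] at h1
  have k : ∀ i, i ≠ 0 → φ x i = 0 := by
    intro i hi
    have h2 := congrFun h1 i
    have : φ x 0 * φ x i = 0 := by
      fin_cases i
      · exact absurd rfl hi
      all_goals
        simp [octMul_eq, e] at h2
        simp only [Fin.mk_one, Fin.reduceFinMk]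
        linarith
    exact (mul_eq_zero.mp this).resolve_left hne
  have h3 : φ x = φ (φ x 0 • e 0) := by
    rw [map_smul, map_one_of_mem hφ]
    ext i
    by_cases hi : i = 0
    · subst hi
      simp [e]
    · simp [e, k i hi, hi]
  have h4 := congrFun (φ.injective h3) 0
  rw [h] at h4
  exact hne (by simpa [e] using h4.symm)

/-- The linear map `c ↦ baseVec c`, followed by the action of `φ`. -/
noncomputable def transport (φ : Oct ≃ₗ[ℝ] Oct) : (Fin 11 → ℝ) →ₗ[ℝ] Oct × Oct where
  toFun c := (φ (baseVec c).1, φ (baseVec c).2)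
  map_add' c d := by
    rw [Prod.mk_add_mk, ← map_add, ← map_add]
    simp only [baseVec, Pi.add_apply, add_smul, Finset.sum_add_distrib, Matrix.add_mulVec]
  map_smul' s c := by
    rw [RingHom.id_apply, Prod.smul_mk, ← map_smul, ← map_smul]
    simp only [baseVec, Pi.smul_apply, smul_eq_mul, mul_smul, ← Finset.smul_sum,
      Matrix.smul_mulVec]

theorem exists_baseVec_eq {V : Oct × Oct} (hV : V ∈ tangent basePoint) : ∃ c, baseVec c = V := by
  obtain ⟨h1, h2, h3, h4, h5⟩ := hV
  simp [basePoint, e] at h3 h4 h5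
  have h6 : V.1 2 = -V.2 1 := by linarith
  have s3 : √3 ^ 2 = 3 := Real.sq_sqrt (by norm_num)
  -- The coefficients solve the linear system displayed in `baseVec_eq`.
  refine ⟨![-√3 * V.2 3, √3 * V.1 3, √3 * V.2 1, V.2 4 - V.1 7, V.1 6 + V.2 5, V.2 6 - V.1 5,
    V.1 4 + V.2 7, √3 * (V.1 6 - V.2 5), √3 * (V.1 7 + V.2 4), √3 * (V.2 7 - V.1 4),
    -√3 * (V.1 5 + V.2 6)], ?_⟩
  rw [baseVec_eq]
  refine Prod.ext ?_ ?_ <;> ext i <;> fin_cases i <;>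
    simp only [Fin.zero_eta, Fin.mk_one, Fin.reduceFinMk, Matrix.cons_val] <;>
    (try simp only [h1, h2, h3, h4, h6]) <;> ring_nf <;> (try rw [s3]) <;> ring

theorem mem_range_transport {φ : Oct ≃ₗ[ℝ] Oct} (hφ : φ ∈ G2) {V : Oct × Oct}
    (hV : V ∈ tangent (φ basePoint.1, φ basePoint.2)) : ∃ c, transport φ c = V := by
  have hi : φ.symm ∈ G2 := G2.inv_mem hφ
  have b1 : basePoint.1 0 = 0 := by simp [basePoint, e]
  have b2 : basePoint.2 0 = 0 := by simp [basePoint, e]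
  have hdot : ∀ x y : Oct, x 0 = 0 → y 0 = 0 → φ.symm x ⬝ᵥ y = x ⬝ᵥ φ y := by
    intro x y hx hy
    rw [← dot_of_mem hφ _ _ (coord_zero_of_mem hi hx) hy, φ.apply_symm_apply]
  obtain ⟨h1, h2, h3, h4, h5⟩ := hV
  obtain ⟨c, hc⟩ := exists_baseVec_eq (V := (φ.symm V.1, φ.symm V.2))
    ⟨coord_zero_of_mem hi h1, coord_zero_of_mem hi h2, by rw [hdot _ _ h1 b1, h3],
      by rw [hdot _ _ h2 b2, h4], by rw [hdot _ _ h1 b2, hdot _ _ h2 b1, h5]⟩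
  refine ⟨c, ?_⟩
  show (φ (baseVec c).1, φ (baseVec c).2) = V
  simp [hc]

/-- This upper bound, together with injectivity of the differential of a parametrization, identifies
the image of the differential with `tangent q`. -/
theorem finrank_tangent_le {q : Oct × Oct} (hq : q ∈ stiefel) :
    Module.finrank ℝ (tangent q) ≤ 11 := by
  obtain ⟨φ, hφ, rfl⟩ := exists_mem_G2 hq
  have h1 : tangent (φ basePoint.1, φ basePoint.2) ≤ LinearMap.range (transport φ) :=
    fun V hV => mem_range_transport hφ hV
  refine (Submodule.finrank_mono h1).trans ?_
  simpa using LinearMap.finrank_range_le (transport φ)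

/-- The component of `V`, tangent at `q`, along the fibres of the projection to the
Grassmannian. -/
def fib (q V : Oct × Oct) : ℝ := V.1 ⬝ᵥ q.2

/-- The first component of the horizontal part of `V`, tangent at `q`. -/
def hor₁ (q V : Oct × Oct) : Oct := V.1 - fib q V • q.2

/-- The second component of the horizontal part of `V`, tangent at `q`. -/
def hor₂ (q V : Oct × Oct) : Oct := V.2 + fib q V • q.1

/-- Replaces the choice of a group element in `metric` by a formula that is bilinear in the tangent
vectors and polynomial in the point. -/
theorem metric_eq (r : ℝ) {q V W : Oct × Oct} (hq : q ∈ stiefel) (hV : V ∈ tangent q)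
    (hW : W ∈ tangent q) :
    metric r q V W = V.1 ⬝ᵥ W.1 + V.2 ⬝ᵥ W.2 + (3 * r - 2) * fib q V * fib q W := by
  obtain ⟨φ, hφ, rfl⟩ := exists_mem_G2 hq
  obtain ⟨c, rfl⟩ := mem_range_transport hφ hV
  obtain ⟨d, rfl⟩ := mem_range_transport hφ hW
  exact (metric_apply r φ hφ c d).trans (weight_sum r hφ c d)

/-- Positivity is read off from this diagonal form, since the ambient form below need not be
positive. -/
theorem metric_eq_weight_sum (r : ℝ) {q V W : Oct × Oct} (hq : q ∈ stiefel) (hV : V ∈ tangent q)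
    (hW : W ∈ tangent q) : ∃ c d : Fin 11 → ℝ, metric r q V W = ∑ i, weight r i * c i * d i ∧
      metric r q V V = ∑ i, weight r i * c i * c i ∧
      metric r q W W = ∑ i, weight r i * d i * d i ∧ (c = 0 → V = 0) := by
  obtain ⟨φ, hφ, rfl⟩ := exists_mem_G2 hq
  obtain ⟨c, rfl⟩ := mem_range_transport hφ hV
  obtain ⟨d, rfl⟩ := mem_range_transport hφ hW
  exact ⟨c, d, metric_apply r φ hφ c d, metric_apply r φ hφ c c, metric_apply r φ hφ d d,
    fun h => by rw [h, map_zero]⟩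

theorem weight_pos {r : ℝ} (hr : 0 < r) (i : Fin 11) : 0 < weight r i := by
  fin_cases i <;> simp [weight, hr]

theorem metric_cauchy_schwarz {r : ℝ} (hr : 0 < r) {q V W : Oct × Oct} (hq : q ∈ stiefel)
    (hV : V ∈ tangent q) (hW : W ∈ tangent q) :
    0 ≤ metric r q V V * metric r q W W - metric r q V W ^ 2 := by
  obtain ⟨c, d, h1, h2, h3, -⟩ := metric_eq_weight_sum r hq hV hW
  have h := Finset.sum_sq_le_sum_mul_sum_of_sq_le_mul Finset.univ
    (r := fun i => weight r i * c i * d i) (f := fun i => weight r i * c i * c i)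
    (g := fun i => weight r i * d i * d i)
    (fun i _ => by rw [mul_assoc]; exact mul_nonneg (weight_pos hr i).le (mul_self_nonneg _))
    (fun i _ => by rw [mul_assoc]; exact mul_nonneg (weight_pos hr i).le (mul_self_nonneg _))
    (fun i _ => le_of_eq (by ring))
  rw [h1, h2, h3]
  linarith

theorem eq_zero_of_metric_self {r : ℝ} (hr : 0 < r) {q V : Oct × Oct} (hq : q ∈ stiefel)
    (hV : V ∈ tangent q) (h : metric r q V V = 0) : V = 0 := by
  obtain ⟨c, d, -, h2, -, h4⟩ := metric_eq_weight_sum r hq hV hV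
  apply h4
  rw [h2, Finset.sum_eq_zero_iff_of_nonneg fun i _ => by
    rw [mul_assoc]; exact mul_nonneg (weight_pos hr i).le (mul_self_nonneg _)] at h
  ext i
  have := h i (Finset.mem_univ i)
  simpa [mul_assoc, (weight_pos hr i).ne'] using this

/-! ### The embedding by `a ∧ b` and its second fundamental form. -/

/-- The bivector `x ∧ y`, as a skew-symmetric matrix. -/
def wedge (x y : Oct) : Fin 8 → Fin 8 → ℝ := fun i j => x i * y j - x j * y i

theorem sum_wedge_mul_wedge (x y z w : Oct) :
    ∑ i, ∑ j, wedge x y i j * wedge z w i j =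
      2 * ((x ⬝ᵥ z) * (y ⬝ᵥ w) - (x ⬝ᵥ w) * (y ⬝ᵥ z)) := by
  have h : ∀ x y z w : Oct, (x ⬝ᵥ z) * (y ⬝ᵥ w) = ∑ i, ∑ j, x i * y j * z i * w j := by
    intro x y z w
    simp only [dotProduct, Finset.sum_mul_sum]
    exact Finset.sum_congr rfl fun i _ => Finset.sum_congr rfl fun j _ => by ring
  have h2 : (x ⬝ᵥ z) * (y ⬝ᵥ w) - (x ⬝ᵥ w) * (y ⬝ᵥ z) =
      ∑ i, ∑ j, (x i * y j * z i * w j - x i * y j * w i * z j) := by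
    rw [h, h]
    simp only [Finset.sum_sub_distrib]
  -- The same double sum with its indices exchanged; adding both versions produces the
  -- antisymmetrized products.
  have h3 : (x ⬝ᵥ z) * (y ⬝ᵥ w) - (x ⬝ᵥ w) * (y ⬝ᵥ z) =
      ∑ i, ∑ j, (x j * y i * z j * w i - x j * y i * w j * z i) := by
    rw [h2, Finset.sum_comm]
  rw [two_mul]
  nth_rewrite 1 [h2]
  rw [h3]
  simp only [← Finset.sum_add_distrib, wedge]
  exact Finset.sum_congr rfl fun i _ => Finset.sum_congr rfl fun j _ => by ring

/-- The inner product of bivectors. -/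
noncomputable def pair : (Fin 8 → Fin 8 → ℝ) →ₗ[ℝ] (Fin 8 → Fin 8 → ℝ) →ₗ[ℝ] ℝ :=
  LinearMap.mk₂ ℝ (fun θ η => (1 / 2) * ∑ i, ∑ j, θ i j * η i j)
    (fun a b c => by simp [add_mul, Finset.sum_add_distrib, mul_add])
    (fun s a b => by simp [mul_assoc, Finset.mul_sum, mul_left_comm])
    (fun a b c => by simp [Finset.sum_add_distrib, mul_add])
    (fun s a b => by simp [Finset.mul_sum, mul_left_comm])

theorem pair_apply (θ η : Fin 8 → Fin 8 → ℝ) : pair θ η = (1 / 2) * ∑ i, ∑ j, θ i j * η i j := rfl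

theorem pair_wedge (x y z w : Oct) :
    pair (wedge x y) (wedge z w) = (x ⬝ᵥ z) * (y ⬝ᵥ w) - (x ⬝ᵥ w) * (y ⬝ᵥ z) := by
  rw [pair_apply, sum_wedge_mul_wedge]
  ring

/-- The space containing the image of the isometric embedding `(a, b) ↦ (a, b, a ∧ b)`. -/
abbrev Ambient : Type := (Oct × Oct) × (Fin 8 → Fin 8 → ℝ)

/-- The bilinear form on `Ambient` that induces the metric. -/
noncomputable def ambientForm (ρ : ℝ) : Ambient →ₗ[ℝ] Ambient →ₗ[ℝ] ℝ :=
  LinearMap.mk₂ ℝ (fun X Y => ρ * (X.1.1 ⬝ᵥ Y.1.1 + X.1.2 ⬝ᵥ Y.1.2) + (1 - ρ) * pair X.2 Y.2)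
    (fun a b c => by simp [add_dotProduct]; ring)
    (fun s a b => by simp [smul_dotProduct]; ring)
    (fun a b c => by simp [dotProduct_add]; ring)
    (fun s a b => by simp [dotProduct_smul]; ring)

theorem ambientForm_apply (ρ : ℝ) (X Y : Ambient) : ambientForm ρ X Y =
    ρ * (X.1.1 ⬝ᵥ Y.1.1 + X.1.2 ⬝ᵥ Y.1.2) + (1 - ρ) * pair X.2 Y.2 := rfl

theorem ambientForm_comm (ρ : ℝ) (X Y : Ambient) : ambientForm ρ X Y = ambientForm ρ Y X := by
  simp only [ambientForm_apply, pair_apply, dotProduct_comm, mul_comm]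

/-- The image of `V`, tangent at `q`, under the differential of `(a, b) ↦ (a, b, a ∧ b)`. -/
def push (q V : Oct × Oct) : Ambient := (V, wedge V.1 q.2 + wedge q.1 V.2)

/-- Both `v₁` and `v₂` are orthogonal to `a` and `b`. -/
structure IsHorizontal (a b v₁ v₂ : Oct) : Prop where
  av₁ : a ⬝ᵥ v₁ = 0
  av₂ : a ⬝ᵥ v₂ = 0
  bv₁ : b ⬝ᵥ v₁ = 0
  bv₂ : b ⬝ᵥ v₂ = 0

theorem isHorizontal_hor {q V : Oct × Oct} (hq : q ∈ stiefel) (hV : V ∈ tangent q) :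
    IsHorizontal q.1 q.2 (hor₁ q V) (hor₂ q V) := by
  obtain ⟨-, -, h3, h4, h5⟩ := hq
  obtain ⟨-, -, k3, k4, k5⟩ := hV
  have h6 : q.2 ⬝ᵥ q.1 = 0 := by rw [dotProduct_comm, h5]
  have e : fib q V = V.1 ⬝ᵥ q.2 := rfl
  constructor <;> rw [dotProduct_comm] <;>
    simp only [hor₁, hor₂, sub_dotProduct, add_dotProduct, smul_dotProduct, h3, h4, h5, h6, k3, k4,
      smul_eq_mul, e] <;> linarith

/-- The form taken by the values of the second fundamental form `sff`. -/
def normalVec (κ : ℝ) (a b : Oct) (α σ β μ : ℝ) (p₁ p₂ : Oct) (θ : Fin 8 → Fin 8 → ℝ) : Ambient :=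
  ((α • a + σ • b + κ • p₁, σ • a + β • b + κ • p₂),
    θ + μ • wedge a b - (1 - κ) • (wedge p₁ b + wedge a p₂))

/-- The second fundamental form of the embedding `(a, b) ↦ (a, b, a ∧ b)`. -/
noncomputable def sff (ρ : ℝ) (a b v₁ v₂ w₁ w₂ : Oct) (t s : ℝ) : Ambient :=
  normalVec (1 - ρ) a b (-(v₁ ⬝ᵥ w₁ + t * s)) (-(v₁ ⬝ᵥ w₂ + w₁ ⬝ᵥ v₂) / 2)
    (-(v₂ ⬝ᵥ w₂ + t * s)) (-(v₁ ⬝ᵥ w₁ + v₂ ⬝ᵥ w₂)) (t • w₂ + s • v₂) (-(t • w₁ + s • v₁))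
    (wedge v₁ w₂ + wedge w₁ v₂)

section

variable {a b v₁ v₂ w₁ w₂ x₁ x₂ : Oct}

/-- The blocks built from `a`, `b`, from `a ∧ b`, from purely horizontal bivectors and from `p` are
mutually orthogonal. The `p` block contributes `ρ(1 - ρ)² + (1 - ρ)ρ² = ρ(1 - ρ)`. -/
theorem ambientForm_normalVec (ρ : ℝ) (aa : a ⬝ᵥ a = 1) (bb : b ⬝ᵥ b = 1) (ab : a ⬝ᵥ b = 0)
    {p₁ p₂ p₁' p₂' x₁ x₂ y₁ y₂ x₁' x₂' y₁' y₂' : Oct}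
    (hp : IsHorizontal a b p₁ p₂) (hp' : IsHorizontal a b p₁' p₂')
    (hx : IsHorizontal a b x₁ x₂) (hx' : IsHorizontal a b x₁' x₂')
    (hy : IsHorizontal a b y₁ y₂) (hy' : IsHorizontal a b y₁' y₂')
    (α σ β μ α' σ' β' μ' : ℝ) :
    ambientForm ρ (normalVec (1 - ρ) a b α σ β μ p₁ p₂ (wedge x₁ x₂ + wedge y₁ y₂))
      (normalVec (1 - ρ) a b α' σ' β' μ' p₁' p₂' (wedge x₁' x₂' + wedge y₁' y₂')) =
    ρ * (α * α' + 2 * σ * σ' + β * β') + (1 - ρ) * (μ * μ' +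
      pair (wedge x₁ x₂ + wedge y₁ y₂) (wedge x₁' x₂' + wedge y₁' y₂')) +
      ρ * (1 - ρ) * (p₁ ⬝ᵥ p₁' + p₂ ⬝ᵥ p₂') := by
  have ba : b ⬝ᵥ a = 0 := by rw [dotProduct_comm, ab]
  obtain ⟨g1, g2, g3, g4⟩ := hp
  obtain ⟨h1, h2, h3, h4⟩ := hp'
  obtain ⟨i1, i2, i3, i4⟩ := hx
  obtain ⟨j1, j2, j3, j4⟩ := hx'
  obtain ⟨k1, k2, k3, k4⟩ := hy
  obtain ⟨l1, l2, l3, l4⟩ := hy'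
  have c1 := dotProduct_comm p₁ a
  have c2 := dotProduct_comm p₁ b
  have c3 := dotProduct_comm p₂ a
  have c4 := dotProduct_comm p₂ b
  have d1 := dotProduct_comm x₁ a
  have d2 := dotProduct_comm x₁ b
  have d3 := dotProduct_comm x₂ a
  have d4 := dotProduct_comm x₂ b
  have e1 := dotProduct_comm y₁ a
  have e2 := dotProduct_comm y₁ b
  have e3 := dotProduct_comm y₂ a
  have e4 := dotProduct_comm y₂ b
  simp only [ambientForm_apply, normalVec, map_add, map_sub, map_smul, LinearMap.add_apply,
    LinearMap.sub_apply, LinearMap.smul_apply, pair_wedge, add_dotProduct, dotProduct_add,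
    smul_dotProduct, dotProduct_smul, smul_eq_mul, aa, bb, ab, ba, g1, g2, g3, g4, h1, h2, h3, h4,
    i1, i2, i3, i4, j1, j2, j3, j4, k1, k2, k3, k4, l1, l2, l3, l4, c1, c2, c3, c4, d1, d2, d3, d4,
    e1, e2, e3, e4]
  ring

theorem IsHorizontal.combine (hv : IsHorizontal a b v₁ v₂) (hw : IsHorizontal a b w₁ w₂)
    (t s : ℝ) : IsHorizontal a b (t • w₂ + s • v₂) (-(t • w₁ + s • v₁)) := by
  obtain ⟨h1, h2, h3, h4⟩ := hv
  obtain ⟨k1, k2, k3, k4⟩ := hw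
  constructor <;>
    simp only [dotProduct_add, dotProduct_neg, dotProduct_smul, h1, h2, h3, h4, k1, k2, k3, k4,
      smul_zero, add_zero, neg_zero]

theorem IsHorizontal.mix (hv : IsHorizontal a b v₁ v₂) (hw : IsHorizontal a b w₁ w₂) :
    IsHorizontal a b v₁ w₂ :=
  ⟨hv.av₁, hw.av₂, hv.bv₁, hw.bv₂⟩

/-- The curvature quartic of the Stiefel manifold, in terms of the horizontal parts of the two
tangent vectors and of their components along the fibre. -/
noncomputable def quartic (r : ℝ) (v₁ v₂ w₁ w₂ : Oct) (t s : ℝ) : ℝ :=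
  (1 / 2) * ∑ i, ∑ j, (wedge v₁ w₁ i j + wedge v₂ w₂ i j) ^ 2 +
    (1 - 9 / 4 * r) * (v₁ ⬝ᵥ w₂ - v₂ ⬝ᵥ w₁) ^ 2 +
    9 / 4 * r ^ 2 * ((t • w₁ - s • v₁) ⬝ᵥ (t • w₁ - s • v₁) +
      (t • w₂ - s • v₂) ⬝ᵥ (t • w₂ - s • v₂))

/-- The right-hand side of the Gauss equation, evaluated for `ρ = 3r/2`. Every term reduces to dot
products of the horizontal parts. -/
theorem ambientForm_sff (r : ℝ) (aa : a ⬝ᵥ a = 1) (bb : b ⬝ᵥ b = 1) (ab : a ⬝ᵥ b = 0)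
    (hv : IsHorizontal a b v₁ v₂) (hw : IsHorizontal a b w₁ w₂) (t s : ℝ) :
    ambientForm (3 / 2 * r) (sff (3 / 2 * r) a b v₁ v₂ v₁ v₂ t t)
        (sff (3 / 2 * r) a b w₁ w₂ w₁ w₂ s s) -
      ambientForm (3 / 2 * r) (sff (3 / 2 * r) a b v₁ v₂ w₁ w₂ t s)
        (sff (3 / 2 * r) a b v₁ v₂ w₁ w₂ t s) =
      quartic r v₁ v₂ w₁ w₂ t s := by
  have h1 : (1 / 2) * ∑ i, ∑ j, (wedge v₁ w₁ i j + wedge v₂ w₂ i j) ^ 2 =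
      pair (wedge v₁ w₁ + wedge v₂ w₂) (wedge v₁ w₁ + wedge v₂ w₂) := by
    simp only [pair_apply, Pi.add_apply, sq]
  rw [quartic, h1]
  simp only [sff]
  rw [ambientForm_normalVec _ aa bb ab (hv.combine hv t t) (hw.combine hw s s) hv hw hv hw,
    ambientForm_normalVec _ aa bb ab (hv.combine hw t s) (hv.combine hw t s) (hv.mix hw)
      (hv.mix hw) (hw.mix hv) (hw.mix hv)]
  simp only [map_add, LinearMap.add_apply, pair_wedge, add_dotProduct, dotProduct_add,
    sub_dotProduct, dotProduct_sub, neg_dotProduct, dotProduct_neg,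
    smul_dotProduct, dotProduct_smul, smul_eq_mul, dotProduct_comm w₁ v₁, dotProduct_comm w₁ v₂,
    dotProduct_comm w₂ v₁, dotProduct_comm w₂ v₂, dotProduct_comm v₂ v₁, dotProduct_comm w₂ w₁]
  ring

/-- A horizontal vector gets weight `ρ + (1 - ρ) = 1`. The fibre direction `(b, -a)` is killed by
the wedge and has squared length `2ρ`, which must equal `3r`; hence `ρ = 3r/2`. -/
theorem ambientForm_push (r : ℝ) {q V W : Oct × Oct} (hq : q ∈ stiefel) (hV : V ∈ tangent q)
    (hW : W ∈ tangent q) :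
    ambientForm (3 / 2 * r) (push q V) (push q W) = metric r q V W := by
  rw [metric_eq r hq hV hW]
  obtain ⟨-, -, h3, h4, h5⟩ := hq
  obtain ⟨-, -, k3, k4, k5⟩ := hV
  obtain ⟨-, -, l3, l4, l5⟩ := hW
  have k6 : V.2 ⬝ᵥ q.1 = -(V.1 ⬝ᵥ q.2) := by linarith
  have l6 : W.2 ⬝ᵥ q.1 = -(W.1 ⬝ᵥ q.2) := by linarith
  simp only [ambientForm_apply, push, map_add, LinearMap.add_apply, pair_wedge, fib, h3, h4, h5,
    k3, k4, k6, l3, l4, l6, dotProduct_comm q.1 W.1, dotProduct_comm q.2 W.2,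
    dotProduct_comm q.2 W.1, dotProduct_comm q.1 W.2, dotProduct_comm q.2 q.1]
  ring

/-- The coefficients `1 - ρ` and `-ρ` of the `p` terms in `normalVec` are chosen so that their two
pairings with a horizontal vector cancel. -/
theorem ambientForm_sff_push (ρ : ℝ) {q Z : Oct × Oct} (hq : q ∈ stiefel)
    (hv : IsHorizontal q.1 q.2 v₁ v₂) (hw : IsHorizontal q.1 q.2 w₁ w₂) (t s : ℝ)
    (hZ : Z ∈ tangent q) :
    ambientForm ρ (sff ρ q.1 q.2 v₁ v₂ w₁ w₂ t s) (push q Z) = 0 := by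
  obtain ⟨-, -, aa, bb, ab⟩ := hq
  obtain ⟨-, -, k3, k4, k5⟩ := hZ
  have k6 : Z.2 ⬝ᵥ q.1 = -(Z.1 ⬝ᵥ q.2) := by linarith
  obtain ⟨h1, h2, h3, h4⟩ := hv
  obtain ⟨i1, i2, i3, i4⟩ := hw
  have ba : q.2 ⬝ᵥ q.1 = 0 := by rw [dotProduct_comm, ab]
  simp only [ambientForm_apply, sff, normalVec, push, map_add, map_sub, map_smul,
    LinearMap.add_apply, LinearMap.sub_apply, LinearMap.smul_apply, pair_wedge, add_dotProduct,
    smul_dotProduct, neg_dotProduct, dotProduct_add, dotProduct_smul, dotProduct_neg, smul_eq_mul,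
    aa, bb, ab, ba, dotProduct_comm _ Z.1, dotProduct_comm _ Z.2, k3, k4, k6,
    dotProduct_comm v₁ q.1, dotProduct_comm v₁ q.2, dotProduct_comm v₂ q.1, dotProduct_comm v₂ q.2,
    dotProduct_comm w₁ q.1, dotProduct_comm w₁ q.2, dotProduct_comm w₂ q.1,
    dotProduct_comm w₂ q.2, h1, h2, h3, h4, i1, i2, i3, i4]
  ring

end

/-- The second derivative of the embedding along vectors `V`, `W` tangent at `q`, for a
parametrization with second derivative `A`, is normal up to the image of a tangent vector. -/
theorem exists_sff_add_push (ρ : ℝ) {q V W A : Oct × Oct} (hq : q ∈ stiefel)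
    (hV : V ∈ tangent q) (hW : W ∈ tangent q) (A1 : A.1 0 = 0) (A2 : A.2 0 = 0)
    (A3 : A.1 ⬝ᵥ q.1 = -(V.1 ⬝ᵥ W.1)) (A4 : A.2 ⬝ᵥ q.2 = -(V.2 ⬝ᵥ W.2))
    (A5 : A.1 ⬝ᵥ q.2 + A.2 ⬝ᵥ q.1 = -(V.1 ⬝ᵥ W.2 + W.1 ⬝ᵥ V.2)) :
    ∃ Y ∈ tangent q, ((A, wedge V.1 W.2 + wedge W.1 V.2 + (wedge A.1 q.2 + wedge q.1 A.2)) :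
      Ambient) = sff ρ q.1 q.2 (hor₁ q V) (hor₂ q V) (hor₁ q W) (hor₂ q W) (fib q V) (fib q W) +
        push q Y := by
  have hv := isHorizontal_hor hq hV
  have hw := isHorizontal_hor hq hW
  have V0 := hV.1
  have V0' := hV.2.1
  have W0 := hW.1
  have W0' := hW.2.1
  have eV1 : V.1 = hor₁ q V + fib q V • q.2 := by rw [hor₁]; abel
  have eV2 : V.2 = hor₂ q V - fib q V • q.1 := by rw [hor₂]; abel
  have eW1 : W.1 = hor₁ q W + fib q W • q.2 := by rw [hor₁]; abel
  have eW2 : W.2 = hor₂ q W - fib q W • q.1 := by rw [hor₂]; abel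
  have v10 : hor₁ q V 0 = 0 := by simp [hor₁, V0, hq.2.1]
  have v20 : hor₂ q V 0 = 0 := by simp [hor₂, V0', hq.1]
  have w10 : hor₁ q W 0 = 0 := by simp [hor₁, W0, hq.2.1]
  have w20 : hor₂ q W 0 = 0 := by simp [hor₂, W0', hq.1]
  rw [eV1, eW1] at A3
  rw [eV2, eW2] at A4
  rw [eV1, eW1, eV2, eW2] at A5
  rw [eV1, eW1, eV2, eW2]
  generalize hor₁ q V = v₁ at *
  generalize hor₂ q V = v₂ at *
  generalize hor₁ q W = w₁ at *
  generalize hor₂ q W = w₂ at *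
  generalize fib q V = t at *
  generalize fib q W = s at *
  clear eV1 eV2 eW1 eW2 hV hW V0 V0' W0 W0'
  obtain ⟨a0, b0, aa, bb, ab⟩ := hq
  have ba : q.2 ⬝ᵥ q.1 = 0 := by rw [dotProduct_comm, ab]
  obtain ⟨h1, h2, h3, h4⟩ := hv
  obtain ⟨i1, i2, i3, i4⟩ := hw
  have c1 := dotProduct_comm v₁ q.1
  have c2 := dotProduct_comm v₁ q.2
  have c3 := dotProduct_comm v₂ q.1
  have c4 := dotProduct_comm v₂ q.2
  have d1 := dotProduct_comm w₁ q.1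
  have d2 := dotProduct_comm w₁ q.2
  have d3 := dotProduct_comm w₂ q.1
  have d4 := dotProduct_comm w₂ q.2
  simp only [add_dotProduct, sub_dotProduct, dotProduct_add, dotProduct_sub, smul_dotProduct,
    dotProduct_smul, smul_eq_mul, aa, bb, ba, c1, c2, c3, d1, h1, h2, h3, h4, i1, i2, i3,
    i4] at A3 A4 A5
  -- This `Y` makes the frame components agree by definition. The constraints on `A` make it
  -- tangent, and the bivector components then agree identically.
  refine ⟨A - (sff ρ q.1 q.2 v₁ v₂ w₁ w₂ t s).1, ⟨?_, ?_, ?_, ?_, ?_⟩, Prod.ext ?_ ?_⟩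
  · simp [sff, normalVec, A1, a0, b0, v20, w20]
  · simp [sff, normalVec, A2, a0, b0, v10, w10]
  · simp only [sff, normalVec, Prod.fst_sub, sub_dotProduct, add_dotProduct, smul_dotProduct, A3,
      aa, ba, c3, d3, h2, i2, smul_eq_mul]
    ring
  · simp only [sff, normalVec, Prod.snd_sub, sub_dotProduct, add_dotProduct, smul_dotProduct, A4,
      neg_dotProduct, bb, ab, c2, d2, h3, i3, smul_eq_mul]
    ring
  · simp only [sff, normalVec, Prod.snd_sub, Prod.fst_sub, sub_dotProduct, add_dotProduct,
      smul_dotProduct, neg_dotProduct, aa, bb, ab, ba, c1, c4, d1, d4, h1, h4, i1, i4, smul_eq_mul]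
    linarith
  · simp [push]
  · funext i j
    simp [push, sff, normalVec, wedge]
    ring

end StiefelG2

/-! ### Differentiating the equations of a submanifold along a parametrization. -/

namespace RiemannianCoords

variable {n : ℕ} {F : Type*} [NormedAddCommGroup F] [NormedSpace ℝ F]
  {M : Set F} {U : Set (Fin n → ℝ)} {ψ : (Fin n → ℝ) → F}

namespace IsLocalParam

theorem contDiffOn_fderiv (h : IsLocalParam M U ψ) : ContDiffOn ℝ ∞ (fderiv ℝ ψ) U :=
  h.smooth.fderiv_of_isOpen h.isOpen (by simp)

theorem differentiableAt (h : IsLocalParam M U ψ) {x : Fin n → ℝ} (hx : x ∈ U) :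
    DifferentiableAt ℝ ψ x :=
  (h.smooth.differentiableOn (by simp)).differentiableAt (h.isOpen.mem_nhds hx)

theorem differentiableAt_fderiv (h : IsLocalParam M U ψ) {x : Fin n → ℝ} (hx : x ∈ U) :
    DifferentiableAt ℝ (fderiv ℝ ψ) x :=
  (h.contDiffOn_fderiv.differentiableOn (by simp)).differentiableAt (h.isOpen.mem_nhds hx)

end IsLocalParam

variable {G : Type*} [NormedAddCommGroup G] [NormedSpace ℝ G]

theorem IsLocalParam.fderiv_fderiv_quadratic (h : IsLocalParam M U ψ) (β : F →L[ℝ] F →L[ℝ] G)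
    {x : Fin n → ℝ} (hx : x ∈ U) (u v : Fin n → ℝ) :
    fderiv ℝ (fun y => fderiv ℝ (fun z => β (ψ z) (ψ z)) y u) x v =
      β (fderiv ℝ (fderiv ℝ ψ) x v u) (ψ x) + β (fderiv ℝ ψ x u) (fderiv ℝ ψ x v) +
        (β (fderiv ℝ ψ x v) (fderiv ℝ ψ x u) + β (ψ x) (fderiv ℝ (fderiv ℝ ψ) x v u)) := by
  have h1 : (fun y => fderiv ℝ (fun z => β (ψ z) (ψ z)) y u) =ᶠ[nhds x]
      fun y => β (fderiv ℝ ψ y u) (ψ y) + β (ψ y) (fderiv ℝ ψ y u) :=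
    Filter.eventually_of_mem (h.isOpen.mem_nhds hx) fun y hy =>
      fderiv_bilinear β (h.differentiableAt hy) (h.differentiableAt hy) u
  have d1 := h.differentiableAt hx
  have d2 : DifferentiableAt ℝ (fun y => fderiv ℝ ψ y u) x :=
    (h.differentiableAt_fderiv hx).clm_apply (differentiableAt_const _)
  rw [h1.fderiv_eq, fderiv_fun_add (by fun_prop) (by fun_prop), add_apply,
    fderiv_bilinear β d2 d1, fderiv_bilinear β d1 d2,
    fderiv_apply_const (h.differentiableAt_fderiv hx)]

theorem fderiv_eq_zero_of_const {f : (Fin n → ℝ) → G} {k : G} (hU : IsOpen U)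
    (hf : ∀ y ∈ U, f y = k) {x : Fin n → ℝ} (hx : x ∈ U) (u : Fin n → ℝ) : fderiv ℝ f x u = 0 := by
  have h1 : f =ᶠ[nhds x] fun _ => k := Filter.eventually_of_mem (hU.mem_nhds hx) hf
  rw [h1.fderiv_eq]
  simp

theorem IsLocalParam.quadratic_const (h : IsLocalParam M U ψ) (β : F →L[ℝ] F →L[ℝ] G) {k : G}
    (hk : ∀ q ∈ M, β q q = k) {x : Fin n → ℝ} (hx : x ∈ U) (u v : Fin n → ℝ) :
    β (fderiv ℝ ψ x u) (ψ x) + β (ψ x) (fderiv ℝ ψ x u) = 0 ∧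
      β (fderiv ℝ (fderiv ℝ ψ) x v u) (ψ x) + β (fderiv ℝ ψ x u) (fderiv ℝ ψ x v) +
        (β (fderiv ℝ ψ x v) (fderiv ℝ ψ x u) + β (ψ x) (fderiv ℝ (fderiv ℝ ψ) x v u)) = 0 := by
  have h1 : ∀ y ∈ U, fderiv ℝ (fun z => β (ψ z) (ψ z)) y u = 0 := fun y hy =>
    fderiv_eq_zero_of_const h.isOpen (fun z hz => hk _ (h.mapsTo hz)) hy u
  constructor
  · rw [← fderiv_bilinear β (h.differentiableAt hx) (h.differentiableAt hx), h1 x hx]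
  · rw [← h.fderiv_fderiv_quadratic β hx, fderiv_eq_zero_of_const h.isOpen h1 hx]

theorem IsLocalParam.linear_const (h : IsLocalParam M U ψ) (l : F →L[ℝ] G) {k : G}
    (hk : ∀ q ∈ M, l q = k) {x : Fin n → ℝ} (hx : x ∈ U) (u v : Fin n → ℝ) :
    l (fderiv ℝ ψ x u) = 0 ∧ l (fderiv ℝ (fderiv ℝ ψ) x v u) = 0 := by
  have h1 : ∀ y ∈ U, l (fderiv ℝ ψ y u) = 0 := fun y hy => by
    rw [← fderiv_eq_zero_of_const h.isOpen (fun z hz => hk _ (h.mapsTo hz)) hy u]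
    change _ = fderiv ℝ (l ∘ ψ) y u
    rw [fderiv_comp _ l.differentiableAt (h.differentiableAt hy)]
    simp
  refine ⟨h1 x hx, ?_⟩
  rw [← fderiv_eq_zero_of_const h.isOpen h1 hx v]
  have d2 : DifferentiableAt ℝ (fun y => fderiv ℝ ψ y u) x :=
    (h.differentiableAt_fderiv hx).clm_apply (differentiableAt_const _)
  change _ = fderiv ℝ (l ∘ fun y => fderiv ℝ ψ y u) x v
  rw [fderiv_comp _ l.differentiableAt d2, ContinuousLinearMap.comp_apply,
    fderiv_apply_const (h.differentiableAt_fderiv hx)]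
  simp

end RiemannianCoords

/-! ### Curvature of the Stiefel manifold in a parametrization. -/

namespace StiefelG2

open RiemannianCoords

/-- The bilinear form `(V, W) ↦ A V ⬝ᵥ B W`. -/
noncomputable def dotForm (A B : Oct × Oct →ₗ[ℝ] Oct) : Oct × Oct →L[ℝ] Oct × Oct →L[ℝ] ℝ :=
  ((dotProductBilin ℝ ℝ).compl₁₂ A B).toContinuousBilinearMap

theorem dotForm_apply (A B : Oct × Oct →ₗ[ℝ] Oct) (V W : Oct × Oct) :
    dotForm A B V W = A V ⬝ᵥ B W := rfl

/-- The bilinear map `(V, W) ↦ V.1 ∧ W.2`. -/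
noncomputable def wedgeMap : Oct × Oct →L[ℝ] Oct × Oct →L[ℝ] Fin 8 → Fin 8 → ℝ :=
  (LinearMap.mk₂ ℝ (fun V W : Oct × Oct => wedge V.1 W.2)
    (fun a b c => by funext i j; simp [wedge]; ring)
    (fun s a b => by funext i j; simp [wedge]; ring)
    (fun a b c => by funext i j; simp [wedge]; ring)
    (fun s a b => by funext i j; simp [wedge]; ring)).toContinuousBilinearMap

theorem wedgeMap_apply (V W : Oct × Oct) : wedgeMap V W = wedge V.1 W.2 := rfl

section

variable {U : Set (Fin 11 → ℝ)} {ψ : (Fin 11 → ℝ) → Oct × Oct}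

/-- First and second derivatives of the five equations defining `stiefel`, two linear and three
quadratic. The second-order relations are those required by `exists_sff_add_push`. -/
theorem fderiv_param (h : IsLocalParam stiefel U ψ) {x : Fin 11 → ℝ} (hx : x ∈ U)
    (u v : Fin 11 → ℝ) : fderiv ℝ ψ x u ∈ tangent (ψ x) ∧
      (fderiv ℝ (fderiv ℝ ψ) x v u).1 0 = 0 ∧ (fderiv ℝ (fderiv ℝ ψ) x v u).2 0 = 0 ∧
      (fderiv ℝ (fderiv ℝ ψ) x v u).1 ⬝ᵥ (ψ x).1 =
        -((fderiv ℝ ψ x v).1 ⬝ᵥ (fderiv ℝ ψ x u).1) ∧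
      (fderiv ℝ (fderiv ℝ ψ) x v u).2 ⬝ᵥ (ψ x).2 =
        -((fderiv ℝ ψ x v).2 ⬝ᵥ (fderiv ℝ ψ x u).2) ∧
      (fderiv ℝ (fderiv ℝ ψ) x v u).1 ⬝ᵥ (ψ x).2 + (fderiv ℝ (fderiv ℝ ψ) x v u).2 ⬝ᵥ (ψ x).1 =
        -((fderiv ℝ ψ x v).1 ⬝ᵥ (fderiv ℝ ψ x u).2 + (fderiv ℝ ψ x u).1 ⬝ᵥ (fderiv ℝ ψ x v).2) := by
  obtain ⟨a1, b1⟩ := h.linear_const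
    ((ContinuousLinearMap.proj 0).comp (ContinuousLinearMap.fst ℝ Oct Oct))
    (k := (0 : ℝ)) (fun q hq => hq.1) hx u v
  obtain ⟨a2, b2⟩ := h.linear_const
    ((ContinuousLinearMap.proj 0).comp (ContinuousLinearMap.snd ℝ Oct Oct))
    (k := (0 : ℝ)) (fun q hq => hq.2.1) hx u v
  obtain ⟨a3, b3⟩ := h.quadratic_const
    (dotForm (LinearMap.fst ℝ Oct Oct) (LinearMap.fst ℝ Oct Oct))
    (fun q hq => hq.2.2.1) hx u v
  obtain ⟨a4, b4⟩ := h.quadratic_const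
    (dotForm (LinearMap.snd ℝ Oct Oct) (LinearMap.snd ℝ Oct Oct))
    (fun q hq => hq.2.2.2.1) hx u v
  obtain ⟨a5, b5⟩ := h.quadratic_const
    (dotForm (LinearMap.fst ℝ Oct Oct) (LinearMap.snd ℝ Oct Oct))
    (fun q hq => hq.2.2.2.2) hx u v
  simp only [dotForm_apply, LinearMap.fst_apply, LinearMap.snd_apply] at a3 b3 a4 b4 a5 b5
  generalize fderiv ℝ (fderiv ℝ ψ) x v u = A at *
  generalize fderiv ℝ ψ x u = V at *
  generalize fderiv ℝ ψ x v = W at *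
  generalize ψ x = q at *
  rw [dotProduct_comm q.1] at a3 b3 a5 b5
  rw [dotProduct_comm q.2] at a4 b4
  refine ⟨⟨a1, a2, by linarith, by linarith,
    by linarith [dotProduct_comm q.1 V.2]⟩, b1, b2, ?_, ?_, ?_⟩
  · linarith [dotProduct_comm W.1 V.1, dotProduct_comm q.1 A.1]
  · linarith [dotProduct_comm W.2 V.2, dotProduct_comm q.2 A.2]
  · linarith [dotProduct_comm q.1 A.2]

theorem exists_fderiv_eq (h : IsLocalParam stiefel U ψ) {x : Fin 11 → ℝ} (hx : x ∈ U)
    {V : Oct × Oct} (hV : V ∈ tangent (ψ x)) : ∃ u, fderiv ℝ ψ x u = V := by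
  have h1 : LinearMap.range (fderiv ℝ ψ x).toLinearMap ≤ tangent (ψ x) := by
    rintro _ ⟨u, rfl⟩
    exact (fderiv_param h hx u u).1
  have h2 : Module.finrank ℝ (LinearMap.range (fderiv ℝ ψ x).toLinearMap) = 11 := by
    rw [LinearMap.finrank_range_of_inj (h.immersion x hx)]
    simp
  have h3 := Submodule.eq_of_le_of_finrank_le h1
    (by rw [h2]; exact finrank_tangent_le (h.mapsTo hx))
  rw [← h3] at hV
  exact hV

/-- A kernel vector `z` of the Gram matrix gives a tangent vector of length zero. Positivity of
`metric` makes it vanish, and the immersion property makes `z` vanish. -/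
theorem pullback_metric_det_ne_zero {r : ℝ} (hr : 0 < r) (h : IsLocalParam stiefel U ψ)
    {x : Fin 11 → ℝ} (hx : x ∈ U) : (pullback (metric r) ψ x).det ≠ 0 := by
  intro h0
  obtain ⟨z, hz, hz0⟩ := Matrix.exists_mulVec_eq_zero_iff.mpr h0
  apply hz
  apply h.immersion x hx
  rw [map_zero]
  have hq := h.mapsTo hx
  have ht := fun u => (fderiv_param h hx u u).1
  apply eq_zero_of_metric_self hr hq (ht z)
  -- `metric` is not bilinear by construction, so sums are expanded in the ambient form instead.
  have h1 : ∀ a b, metric r (ψ x) (fderiv ℝ ψ x a) (fderiv ℝ ψ x b) =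
      ambientForm (3 / 2 * r) (push (ψ x) (fderiv ℝ ψ x a)) (push (ψ x) (fderiv ℝ ψ x b)) :=
    fun a b => (ambientForm_push r hq (ht a) (ht b)).symm
  have h2 : ∀ a, push (ψ x) (fderiv ℝ ψ x a) =
      ∑ i, a i • push (ψ x) (fderiv ℝ ψ x (Pi.single i 1)) := by
    let P : (Fin 11 → ℝ) →ₗ[ℝ] Ambient :=
      { toFun := fun a => push (ψ x) (fderiv ℝ ψ x a)
        map_add' := fun a b => by
          rw [map_add]
          refine Prod.ext rfl ?_
          funext i j
          simp [push, wedge]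
          ring
        map_smul' := fun s a => by
          rw [map_smul]
          refine Prod.ext rfl ?_
          funext i j
          simp [push, wedge]
          ring }
    intro a
    change P a = ∑ i, a i • P (Pi.single i 1)
    conv_lhs => rw [pi_eq_sum_univ' a]
    simp
  rw [h1]
  nth_rewrite 1 [h2]
  nth_rewrite 1 [h2]
  simp only [map_sum, map_smul, LinearMap.sum_apply, LinearMap.smul_apply, smul_eq_mul, ← h1]
  have h3 := congrArg (fun w => z ⬝ᵥ w) hz0
  simp only [dotProduct_zero] at h3
  rw [← h3]
  simp only [dotProduct, Matrix.mulVec, pullback, Matrix.of_apply, Finset.mul_sum]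
  rw [Finset.sum_comm]
  exact Finset.sum_congr rfl fun i _ => Finset.sum_congr rfl fun j _ => by ring

/-- The curvature quartic in a local parametrization. -/
theorem curvQuartic_param {r : ℝ} (hr : 0 < r) (h : IsLocalParam stiefel U ψ)
    {x : Fin 11 → ℝ} (hx : x ∈ U) (u v : Fin 11 → ℝ) :
    curvQuartic (pullback (metric r) ψ) x u v =
      quartic r (hor₁ (ψ x) (fderiv ℝ ψ x u)) (hor₂ (ψ x) (fderiv ℝ ψ x u))
        (hor₁ (ψ x) (fderiv ℝ ψ x v)) (hor₂ (ψ x) (fderiv ℝ ψ x v))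
        (fib (ψ x) (fderiv ℝ ψ x u)) (fib (ψ x) (fderiv ℝ ψ x v)) := by
  set Φ : (Fin 11 → ℝ) → Ambient := fun y => (ψ y, wedgeMap (ψ y) (ψ y)) with hΦ
  have cΦ : ContDiffOn ℝ ∞ Φ U := by
    refine h.smooth.prodMk ?_
    exact wedgeMap.isBoundedBilinearMap.contDiff.comp_contDiffOn (h.smooth.prodMk h.smooth)
  have dΦ : ∀ y ∈ U, ∀ a, fderiv ℝ Φ y a = push (ψ y) (fderiv ℝ ψ y a) := by
    intro y hy a
    have d1 := h.differentiableAt hy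
    rw [hΦ, DifferentiableAt.fderiv_prodMk d1 (by fun_prop), ContinuousLinearMap.prod_apply,
      fderiv_bilinear wedgeMap d1 d1]
    rfl
  have cD : DifferentiableAt ℝ (fderiv ℝ Φ) x :=
    ((cΦ.fderiv_of_isOpen (m := ∞) h.isOpen (by simp)).differentiableOn
      (by simp)).differentiableAt (h.isOpen.mem_nhds hx)
  have ddΦ : ∀ a b, ∃ w, fderiv ℝ (fderiv ℝ Φ) x a b =
      sff (3 / 2 * r) (ψ x).1 (ψ x).2 (hor₁ (ψ x) (fderiv ℝ ψ x a)) (hor₂ (ψ x) (fderiv ℝ ψ x a))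
        (hor₁ (ψ x) (fderiv ℝ ψ x b)) (hor₂ (ψ x) (fderiv ℝ ψ x b))
        (fib (ψ x) (fderiv ℝ ψ x a)) (fib (ψ x) (fderiv ℝ ψ x b)) + fderiv ℝ Φ x w := by
    intro a b
    obtain ⟨-, A1, A2, A3, A4, A5⟩ := fderiv_param h hx b a
    obtain ⟨Y, hY, e⟩ := exists_sff_add_push (3 / 2 * r) (h.mapsTo hx) (fderiv_param h hx a a).1
      (fderiv_param h hx b b).1 A1 A2 A3 A4 A5
    obtain ⟨w, hw⟩ := exists_fderiv_eq h hx hY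
    refine ⟨w, ?_⟩
    -- The second derivative of the embedding consists of that of `ψ` and the product rule applied
    -- twice to `ψ.1 ∧ ψ.2`.
    rw [dΦ x hx, hw, ← e, ← fderiv_apply_const cD]
    have h1 : (fun y => fderiv ℝ Φ y b) =ᶠ[nhds x]
        fun y => (fderiv ℝ ψ y b, fderiv ℝ (fun z => wedgeMap (ψ z) (ψ z)) y b) :=
      Filter.eventually_of_mem (h.isOpen.mem_nhds hx) fun y hy => by
        have d1 := h.differentiableAt hy
        dsimp only
        rw [hΦ, DifferentiableAt.fderiv_prodMk d1 (by fun_prop), ContinuousLinearMap.prod_apply]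
    have d2 : DifferentiableAt ℝ (fun y => fderiv ℝ ψ y b) x :=
      (h.differentiableAt_fderiv hx).clm_apply (differentiableAt_const _)
    have d3 : DifferentiableAt ℝ (fun y => fderiv ℝ (fun z => wedgeMap (ψ z) (ψ z)) y b) x := by
      have d1 := h.differentiableAt hx
      have : (fun y => fderiv ℝ (fun z => wedgeMap (ψ z) (ψ z)) y b) =ᶠ[nhds x]
        fun y => wedgeMap (fderiv ℝ ψ y b) (ψ y) + wedgeMap (ψ y) (fderiv ℝ ψ y b) :=
        Filter.eventually_of_mem (h.isOpen.mem_nhds hx) fun y hy =>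
          fderiv_bilinear wedgeMap (h.differentiableAt hy) (h.differentiableAt hy) b
      refine DifferentiableAt.congr_of_eventuallyEq ?_ this
      fun_prop
    rw [h1.fderiv_eq, DifferentiableAt.fderiv_prodMk d2 d3, ContinuousLinearMap.prod_apply,
      fderiv_apply_const (h.differentiableAt_fderiv hx), h.fderiv_fderiv_quadratic wedgeMap hx]
    simp only [wedgeMap_apply]
    refine Prod.ext rfl ?_
    dsimp only
    abel
  have hq := h.mapsTo hx
  have ht := fun u => (fderiv_param h hx u u).1
  have hh := fun u => isHorizontal_hor hq (ht u)
  have hn : ∀ a b w, ambientForm (3 / 2 * r) (sff (3 / 2 * r) (ψ x).1 (ψ x).2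
      (hor₁ (ψ x) (fderiv ℝ ψ x a)) (hor₂ (ψ x) (fderiv ℝ ψ x a))
      (hor₁ (ψ x) (fderiv ℝ ψ x b)) (hor₂ (ψ x) (fderiv ℝ ψ x b))
      (fib (ψ x) (fderiv ℝ ψ x a)) (fib (ψ x) (fderiv ℝ ψ x b))) (fderiv ℝ Φ x w) = 0 := by
    intro a b w
    rw [dΦ x hx]
    exact ambientForm_sff_push _ hq (hh a) (hh b) _ _ (ht w)
  obtain ⟨wuu, huu⟩ := ddΦ u u
  obtain ⟨wuv, huv⟩ := ddΦ u v
  obtain ⟨wvv, hvv⟩ := ddΦ v v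
  rw [curvQuartic_eq_of_isometric (ambientForm (3 / 2 * r)).toContinuousBilinearMap
    (ambientForm_comm _) h.isOpen cΦ (fun y hy i j => by
      rw [dΦ y hy, dΦ y hy]
      exact (ambientForm_push r (h.mapsTo hy) (fderiv_param h hy _ 0).1
        (fderiv_param h hy _ 0).1).symm)
    (fun y hy => pullback_metric_det_ne_zero hr h hy) hx u v huu huv hvv (hn u u) (hn u v)]
  exact ambientForm_sff r hq.2.2.1 hq.2.2.2.1 hq.2.2.2.2 (hh u) (hh v) _ _

end

end StiefelG2

/-! ### Existence of local parametrizations. -/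

namespace RiemannianCoords

variable {n : ℕ} {F : Type*} [NormedAddCommGroup F] [NormedSpace ℝ F]

/-- By the chain rule, a differentiable left inverse also provides a left inverse of the
differential. -/
theorem isLocalParam_of_leftInverse {M : Set F} {U : Set (Fin n → ℝ)} {ψ : (Fin n → ℝ) → F}
    (hU : IsOpen U) (hψ : ContDiffOn ℝ ∞ ψ U) (hM : Set.MapsTo ψ U M) {σ : F → Fin n → ℝ}
    (hσ : ∀ x ∈ U, DifferentiableAt ℝ σ (ψ x)) (h : ∀ x ∈ U, σ (ψ x) = x) :
    IsLocalParam M U ψ where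
  isOpen := hU
  smooth := hψ
  mapsTo := hM
  injOn := fun x hx y hy hxy => by rw [← h x hx, hxy, h y hy]
  immersion := by
    intro x hx
    have h1 : DifferentiableAt ℝ ψ x :=
      (hψ.differentiableOn (by simp)).differentiableAt (hU.mem_nhds hx)
    have h2 : fderiv ℝ (σ ∘ ψ) x = ContinuousLinearMap.id ℝ _ := by
      have : σ ∘ ψ =ᶠ[nhds x] id := Filter.eventually_of_mem (hU.mem_nhds hx) h
      rw [this.fderiv_eq, fderiv_id]
    rw [fderiv_comp _ (hσ x hx) h1] at h2
    exact Function.LeftInverse.injective fun u => DFunLike.congr_fun h2 u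

theorem IsLocalParam.comp_linearEquiv {M : Set F} {U : Set (Fin n → ℝ)} {ψ : (Fin n → ℝ) → F}
    (h : IsLocalParam M U ψ) (L : F ≃L[ℝ] F) (hL : Set.MapsTo L M M) :
    IsLocalParam M U (L ∘ ψ) where
  isOpen := h.isOpen
  smooth := L.contDiff.comp_contDiffOn h.smooth
  mapsTo := hL.comp h.mapsTo
  injOn := L.injective.comp_injOn h.injOn
  immersion := by
    intro x hx
    rw [L.comp_fderiv]
    exact L.injective.comp (h.immersion x hx)

end RiemannianCoords

namespace StiefelG2

open RiemannianCoords

/-- The first of two linearly independent vectors depending on `x`. -/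
def spanA (x : Fin 11 → ℝ) : Oct := ![0, 1, x 0, x 1, x 2, x 3, x 4, x 5]

/-- The second of two linearly independent vectors depending on `x`. -/
def spanB (x : Fin 11 → ℝ) : Oct := ![0, 0, 1, x 6, x 7, x 8, x 9, x 10]

/-- The component of `spanB x` orthogonal to `spanA x`. -/
noncomputable def orthB (x : Fin 11 → ℝ) : Oct :=
  spanB x - ((spanB x ⬝ᵥ spanA x) / (spanA x ⬝ᵥ spanA x)) • spanA x

/-- The Gram-Schmidt orthonormalization of `spanA x`, `spanB x`. -/
noncomputable def gramSchmidtFrame (x : Fin 11 → ℝ) : Oct × Oct :=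
  ((√(spanA x ⬝ᵥ spanA x))⁻¹ • spanA x, (√(orthB x ⬝ᵥ orthB x))⁻¹ • orthB x)

/-- A left inverse of `gramSchmidtFrame`. -/
noncomputable def frameCoords (q : Oct × Oct) : Fin 11 → ℝ :=
  let d := q.1 1 * q.2 2 - q.2 1 * q.1 2
  ![q.1 2 / q.1 1, q.1 3 / q.1 1, q.1 4 / q.1 1, q.1 5 / q.1 1, q.1 6 / q.1 1, q.1 7 / q.1 1,
    (q.1 1 * q.2 3 - q.2 1 * q.1 3) / d, (q.1 1 * q.2 4 - q.2 1 * q.1 4) / d,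
    (q.1 1 * q.2 5 - q.2 1 * q.1 5) / d, (q.1 1 * q.2 6 - q.2 1 * q.1 6) / d,
    (q.1 1 * q.2 7 - q.2 1 * q.1 7) / d]

theorem spanA_pos (x : Fin 11 → ℝ) : 0 < spanA x ⬝ᵥ spanA x := by
  rw [dot_eq]
  simp only [spanA, Matrix.cons_val]
  linarith [mul_self_nonneg (x 0), mul_self_nonneg (x 1), mul_self_nonneg (x 2),
    mul_self_nonneg (x 3), mul_self_nonneg (x 4), mul_self_nonneg (x 5)]

theorem orthB_pos (x : Fin 11 → ℝ) : 0 < orthB x ⬝ᵥ orthB x := by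
  refine lt_of_le_of_ne (Finset.sum_nonneg fun i _ => mul_self_nonneg _) fun h => ?_
  have h1 := dotProduct_self_eq_zero.mp h.symm
  have h2 := congrFun h1 1
  have h3 := congrFun h1 2
  simp only [orthB, Pi.sub_apply, Pi.smul_apply, smul_eq_mul, Pi.zero_apply] at h2 h3
  generalize (spanB x ⬝ᵥ spanA x) / (spanA x ⬝ᵥ spanA x) = ν at h2 h3
  simp [spanA, spanB] at h2 h3
  rw [h2] at h3
  simp at h3

theorem orthB_dot_spanA (x : Fin 11 → ℝ) : orthB x ⬝ᵥ spanA x = 0 := by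
  rw [orthB, sub_dotProduct, smul_dotProduct, smul_eq_mul, div_mul_cancel₀ _ (spanA_pos x).ne',
    sub_self]

theorem gramSchmidtFrame_mem (x : Fin 11 → ℝ) : gramSchmidtFrame x ∈ stiefel := by
  have h1 : ∀ y : Oct, 0 < y ⬝ᵥ y → (√(y ⬝ᵥ y))⁻¹ • y ⬝ᵥ (√(y ⬝ᵥ y))⁻¹ • y = 1 := by
    intro y hy
    rw [smul_dotProduct, dotProduct_smul, smul_eq_mul, smul_eq_mul, ← mul_assoc, ← mul_inv,
      Real.mul_self_sqrt hy.le, inv_mul_cancel₀ hy.ne']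
  refine ⟨by simp [gramSchmidtFrame, spanA], by simp [gramSchmidtFrame, orthB, spanA, spanB],
    h1 _ (spanA_pos x), h1 _ (orthB_pos x), ?_⟩
  simp only [gramSchmidtFrame, smul_dotProduct, dotProduct_smul]
  rw [dotProduct_comm (spanA x) (orthB x), orthB_dot_spanA, smul_zero, smul_zero]

/-- Gram-Schmidt only rescales `spanA` and changes `spanB` by a multiple of `spanA` and a scale.
Ratios of coordinates of the first vector, and of 2-by-2 minors of the pair, are unaffected; since
`spanA` and `spanB` begin with `1, x 0` and `0, 1`, these ratios recover all parameters. -/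
theorem frameCoords_aux (x : Fin 11 → ℝ) {l m : ℝ} (ν : ℝ) (hl : 0 < l) (hm : 0 < m) :
    (l • spanA x) 1 ≠ 0 ∧
      (l • spanA x) 1 * (m • (spanB x - ν • spanA x)) 2 -
        (m • (spanB x - ν • spanA x)) 1 * (l • spanA x) 2 ≠ 0 ∧
      frameCoords (l • spanA x, m • (spanB x - ν • spanA x)) = x := by
  have h1 : (l • spanA x) 1 = l := by simp [spanA]
  have h2 : (l • spanA x) 1 * (m • (spanB x - ν • spanA x)) 2 -
        (m • (spanB x - ν • spanA x)) 1 * (l • spanA x) 2 = l * m := by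
    simp [spanA, spanB]
    ring
  refine ⟨by rw [h1]; exact hl.ne', by rw [h2]; exact (mul_pos hl hm).ne', ?_⟩
  funext i
  simp only [frameCoords]
  rw [h2, h1]
  fin_cases i <;> simp [spanA, spanB] <;> field_simp <;> ring

theorem contDiff_gramSchmidtFrame : ContDiff ℝ ∞ gramSchmidtFrame := by
  have hA : ContDiff ℝ ∞ spanA := by
    refine contDiff_pi' fun i => ?_
    fin_cases i <;> simp [spanA] <;> fun_prop
  have hB : ContDiff ℝ ∞ spanB := by
    refine contDiff_pi' fun i => ?_
    fin_cases i <;> simp [spanB] <;> fun_prop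
  have hdot : ∀ {f g : (Fin 11 → ℝ) → Oct}, ContDiff ℝ ∞ f → ContDiff ℝ ∞ g →
      ContDiff ℝ ∞ fun x => f x ⬝ᵥ g x := by
    intro f g hf hg
    simp only [dotProduct]
    fun_prop
  have hO : ContDiff ℝ ∞ orthB :=
    hB.sub (((hdot hB hA).div (hdot hA hA) fun x => (spanA_pos x).ne').smul hA)
  refine ContDiff.prodMk ?_ ?_
  · exact (((hdot hA hA).sqrt fun x => (spanA_pos x).ne').inv
      fun x => (Real.sqrt_pos.mpr (spanA_pos x)).ne').smul hA
  · exact (((hdot hO hO).sqrt fun x => (orthB_pos x).ne').inv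
      fun x => (Real.sqrt_pos.mpr (orthB_pos x)).ne').smul hO

theorem isLocalParam_gramSchmidtFrame : IsLocalParam stiefel Set.univ gramSchmidtFrame := by
  have h := fun x => frameCoords_aux x ((spanB x ⬝ᵥ spanA x) / (spanA x ⬝ᵥ spanA x))
    (inv_pos.mpr (Real.sqrt_pos.mpr (spanA_pos x))) (inv_pos.mpr (Real.sqrt_pos.mpr (orthB_pos x)))
  refine isLocalParam_of_leftInverse isOpen_univ contDiff_gramSchmidtFrame.contDiffOn
    (fun x _ => gramSchmidtFrame_mem x) (σ := frameCoords) (fun x _ => ?_) fun x _ => (h x).2.2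
  obtain ⟨h1, h2, -⟩ := h x
  change (gramSchmidtFrame x).1 1 ≠ 0 at h1
  change (gramSchmidtFrame x).1 1 * (gramSchmidtFrame x).2 2 -
    (gramSchmidtFrame x).2 1 * (gramSchmidtFrame x).1 2 ≠ 0 at h2
  generalize gramSchmidtFrame x = q at *
  refine differentiableAt_pi.mpr fun i => ?_
  fin_cases i <;> simp [frameCoords] <;> fun_prop (disch := assumption)

theorem gramSchmidtFrame_zero : gramSchmidtFrame 0 = basePoint := by
  have hA : spanA 0 = e 1 := by
    ext i
    fin_cases i <;> simp [spanA, e]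
  have hB : spanB 0 = e 2 := by
    ext i
    fin_cases i <;> simp [spanB, e]
  have hO : orthB 0 = e 2 := by
    rw [orthB, hA, hB]
    simp [e]
  rw [gramSchmidtFrame, hA, hO]
  simp [e, basePoint]

/-- One chart around the base point suffices: it is carried to any other point by an element of
`G2`. -/
theorem exists_param {q : Oct × Oct} (hq : q ∈ stiefel) :
    ∃ (U : Set (Fin 11 → ℝ)) (ψ : (Fin 11 → ℝ) → Oct × Oct), IsLocalParam stiefel U ψ ∧
      ∃ x ∈ U, ψ x = q := by
  obtain ⟨φ, hφ, rfl⟩ := exists_mem_G2 hq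
  have h := isLocalParam_gramSchmidtFrame.comp_linearEquiv
    (φ.prodCongr φ).toContinuousLinearEquiv (by
      rintro p ⟨h1, h2, h3, h4, h5⟩
      exact ⟨coord_zero_of_mem hφ h1, coord_zero_of_mem hφ h2,
        (dot_of_mem hφ _ _ h1 h1).trans h3, (dot_of_mem hφ _ _ h2 h2).trans h4,
        (dot_of_mem hφ _ _ h1 h2).trans h5⟩)
  refine ⟨_, _, h, 0, Set.mem_univ _, ?_⟩
  rw [Function.comp_apply, gramSchmidtFrame_zero]
  rfl

theorem isTangent_iff {q V : Oct × Oct} (hq : q ∈ stiefel) :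
    IsTangent 11 stiefel q V ↔ V ∈ tangent q := by
  constructor
  · rintro ⟨U, ψ, h, x, hx, rfl, u, rfl⟩
    exact (fderiv_param h hx u u).1
  · intro hV
    obtain ⟨U, ψ, h, x, hx, rfl⟩ := exists_param hq
    exact ⟨U, ψ, h, x, hx, rfl, exists_fderiv_eq h hx hV⟩

/-- Every parametrization through `q` gives the same value, so the choice made in the definition of
`curv` is immaterial; `exists_param` ensures that there is something to choose. -/
theorem curv_eq {r : ℝ} (hr : 0 < r) {q V W : Oct × Oct} (hq : q ∈ stiefel) (hV : V ∈ tangent q)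
    (hW : W ∈ tangent q) : curv 11 stiefel (metric r) q V W =
      quartic r (hor₁ q V) (hor₂ q V) (hor₁ q W) (hor₂ q W) (fib q V) (fib q W) := by
  have hex : ∃ t : ℝ, ∃ (U : Set (Fin 11 → ℝ)) (ψ : (Fin 11 → ℝ) → Oct × Oct),
      IsLocalParam stiefel U ψ ∧ ∃ x ∈ U, ψ x = q ∧ ∃ u v, fderiv ℝ ψ x u = V ∧
        fderiv ℝ ψ x v = W ∧ t = curvQuartic (pullback (metric r) ψ) x u v := by
    obtain ⟨U, ψ, h, x, hx, rfl⟩ := exists_param hq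
    obtain ⟨u, hu⟩ := exists_fderiv_eq h hx hV
    obtain ⟨v, hv⟩ := exists_fderiv_eq h hx hW
    exact ⟨_, U, ψ, h, x, hx, rfl, u, v, hu, hv, rfl⟩
  obtain ⟨U, ψ, h, x, hx, hxq, u, v, hu, hv, ht⟩ := Classical.epsilon_spec hex
  rw [curv, ht, curvQuartic_param hr h hx, hxq, hu, hv]

open RiemannianCoords

/-! ### Evaluation at the base point. -/

theorem basePoint_mem : basePoint ∈ stiefel := by
  refine ⟨?_, ?_, ?_, ?_, ?_⟩ <;> simp [basePoint, e]

theorem baseVec_mem (c : Fin 11 → ℝ) : baseVec c ∈ tangent basePoint := by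
  rw [baseVec_eq]
  refine ⟨?_, ?_, ?_, ?_, ?_⟩ <;> simp [basePoint, e]

theorem fib_baseVec (c : Fin 11 → ℝ) : fib basePoint (baseVec c) = -(√3 / 3) * c 2 := by
  simp [fib, baseVec_eq, basePoint, e]

theorem hor₁_baseVec (c : Fin 11 → ℝ) : hor₁ basePoint (baseVec c) =
    ![0, 0, 0, (√3 / 3) * c 1, c 6 / 2 - (√3 / 6) * c 9, -(c 5 / 2) - (√3 / 6) * c 10,
      c 4 / 2 + (√3 / 6) * c 7, -(c 3 / 2) + (√3 / 6) * c 8] := by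
  rw [hor₁, fib_baseVec, baseVec_eq]
  ext i
  fin_cases i <;> simp [basePoint, e]

theorem hor₂_baseVec (c : Fin 11 → ℝ) : hor₂ basePoint (baseVec c) =
    ![0, 0, 0, -(√3 / 3) * c 0, c 3 / 2 + (√3 / 6) * c 8, c 4 / 2 - (√3 / 6) * c 7,
      c 5 / 2 - (√3 / 6) * c 10, c 6 / 2 + (√3 / 6) * c 9] := by
  rw [hor₂, fib_baseVec, baseVec_eq]
  ext i
  fin_cases i <;> simp [basePoint, e]

theorem metric_baseVec (r : ℝ) (c d : Fin 11 → ℝ) :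
    metric r basePoint (baseVec c) (baseVec d) = ∑ i, weight r i * c i * d i :=
  metric_apply r 1 G2.one_mem c d

theorem quartic_nonneg {r : ℝ} (hr : r ≤ 4 / 9) (v₁ v₂ w₁ w₂ : Oct) (t s : ℝ) :
    0 ≤ quartic r v₁ v₂ w₁ w₂ t s := by
  have h1 : ∀ y : Oct, 0 ≤ y ⬝ᵥ y := fun y => Finset.sum_nonneg fun i _ => mul_self_nonneg _
  have h2 : 0 ≤ 1 - 9 / 4 * r := by linarith
  have := h1 (t • w₁ - s • v₁)
  have := h1 (t • w₂ - s • v₂)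
  rw [quartic]
  positivity

/-- The horizontal parts are `(0, -e₃/√3)` and `(e₃/√3, 0)`, with no fibre component. Both wedges
vanish and `v₁·w₂ - v₂·w₁ = 1/3`, so the quartic is `(1 - 9r/4)/9` and the Gram determinant is
`1/9`. -/
theorem sectionalCurvature_base {r : ℝ} (hr : 0 < r) :
    sectionalCurvature 11 stiefel (metric r) basePoint (baseVec (Pi.single 0 1))
      (baseVec (Pi.single 1 1)) = 1 - 9 * r / 4 := by
  have s3 : √3 ^ 2 = 3 := Real.sq_sqrt (by norm_num)
  have s4 : √3 ^ 4 = 9 := by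
    rw [show √3 ^ 4 = (√3 ^ 2) ^ 2 by ring, s3]
    norm_num
  rw [sectionalCurvature, curv_eq hr basePoint_mem (baseVec_mem _) (baseVec_mem _),
    metric_baseVec, metric_baseVec, metric_baseVec, hor₁_baseVec, hor₁_baseVec, hor₂_baseVec,
    hor₂_baseVec, fib_baseVec, fib_baseVec]
  have h1 : ∀ i j : Fin 11, ∑ k, weight r k * (Pi.single i 1 : Fin 11 → ℝ) k *
      (Pi.single j 1 : Fin 11 → ℝ) k = if i = j then weight r i else 0 := by
    intro i j
    rw [Finset.sum_eq_single i]
    · simp [Pi.single_apply]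
    · intro k _ hk
      simp [hk]
    · simp
  rw [h1, h1, h1]
  simp [quartic, Fin.sum_univ_eight, wedge, weight]
  ring_nf
  rw [s4]
  ring

/-! ### The curvature quartic as a polynomial, and sums of squares. -/

/-- The polynomials giving `hor₁` of a tangent vector at the base point in the orthonormal
coordinates; `ι` selects the block of variables. -/
noncomputable def horPoly₁ {τ : Type*} (ι : Fin 11 → τ) : Fin 8 → MvPolynomial τ ℝ :=
  ![0, 0, 0, .X (ι 1), .C √(1 / 2) * (.X (ι 6) - .X (ι 9)), .C √(1 / 2) * (-.X (ι 5) - .X (ι 10)),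
    .C √(1 / 2) * (.X (ι 4) + .X (ι 7)), .C √(1 / 2) * (-.X (ι 3) + .X (ι 8))]

/-- The polynomials giving `hor₂` of a tangent vector at the base point in the orthonormal
coordinates; `ι` selects the block of variables. -/
noncomputable def horPoly₂ {τ : Type*} (ι : Fin 11 → τ) : Fin 8 → MvPolynomial τ ℝ :=
  ![0, 0, 0, -.X (ι 0), .C √(1 / 2) * (.X (ι 3) + .X (ι 8)), .C √(1 / 2) * (.X (ι 4) - .X (ι 7)),
    .C √(1 / 2) * (.X (ι 5) - .X (ι 10)), .C √(1 / 2) * (.X (ι 6) + .X (ι 9))]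

theorem div_sqrt_half (a : ℝ) : a / √(1 / 2) / 2 = √(1 / 2) * a := by
  have h : √(1 / 2 : ℝ) * √(1 / 2) = 1 / 2 := Real.mul_self_sqrt (by norm_num)
  have h0 : √(1 / 2 : ℝ) ≠ 0 := by positivity
  field_simp
  linear_combination (-2 * a) * h

theorem div_sqrt_sixth (a : ℝ) : √3 / 6 * (a / √(1 / 6)) = √(1 / 2) * a := by
  have h : √(1 / 2 : ℝ) * √(1 / 6) = √3 / 6 := by
    rw [← Real.sqrt_mul (by norm_num), show (1 / 2 * (1 / 6) : ℝ) = 3 / 6 ^ 2 by norm_num,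
      Real.sqrt_div (by norm_num), Real.sqrt_sq (by norm_num)]
  have h0 : √(1 / 6 : ℝ) ≠ 0 := by positivity
  rw [← h]
  field_simp

theorem div_sqrt_third (a : ℝ) : √3 / 3 * (a / √(1 / 3)) = a := by
  have h : √(1 / 3 : ℝ) = √3 / 3 := by
    rw [show (1 / 3 : ℝ) = 3 / 3 ^ 2 by norm_num, Real.sqrt_div (by norm_num),
      Real.sqrt_sq (by norm_num)]
  rw [h]
  field_simp

/-- The only weight that depends on `r` belongs to the fibre direction, which horizontal parts do
not see; hence the polynomials are free of `r`. -/
theorem eval_horPoly₁ {τ : Type*} (r : ℝ) (ι : Fin 11 → τ) (z : τ → ℝ) :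
    hor₁ basePoint (baseVec (orthoCoords r (z ∘ ι))) =
      fun i => MvPolynomial.eval z (horPoly₁ ι i) := by
  rw [hor₁_baseVec]
  ext i
  fin_cases i <;> simp only [orthoCoords, weight, horPoly₁, Matrix.cons_val, div_sqrt_half,
    div_sqrt_sixth, div_sqrt_third, Fin.zero_eta, Fin.mk_one, Fin.reduceFinMk, map_zero, map_mul,
    map_add, map_sub, map_neg, MvPolynomial.eval_X, MvPolynomial.eval_C, Function.comp_apply] <;>
    ring

theorem eval_horPoly₂ {τ : Type*} (r : ℝ) (ι : Fin 11 → τ) (z : τ → ℝ) :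
    hor₂ basePoint (baseVec (orthoCoords r (z ∘ ι))) =
      fun i => MvPolynomial.eval z (horPoly₂ ι i) := by
  rw [hor₂_baseVec]
  ext i
  fin_cases i <;> simp only [orthoCoords, weight, horPoly₂, Matrix.cons_val, div_sqrt_half,
    div_sqrt_sixth, div_sqrt_third, Fin.zero_eta, Fin.mk_one, Fin.reduceFinMk, map_zero, map_mul,
    map_add, map_sub, map_neg, MvPolynomial.eval_X, MvPolynomial.eval_C, Function.comp_apply,
    neg_mul] <;>
    ring

theorem fib_orthoCoords (r : ℝ) (x : Fin 11 → ℝ) :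
    fib basePoint (baseVec (orthoCoords r x)) = -(√3 / 3) / √r * x 2 := by
  rw [fib_baseVec]
  simp only [orthoCoords, weight, Matrix.cons_val]
  ring

/-- The square of the norm of `v₁ ∧ w₁ + v₂ ∧ w₂`, as a polynomial. -/
noncomputable def wedgePoly : MvPolynomial (Fin 11 ⊕ Fin 11) ℝ :=
  .C (1 / 2) * ∑ i, ∑ j,
    (horPoly₁ .inl i * horPoly₁ .inr j - horPoly₁ .inl j * horPoly₁ .inr i +
      (horPoly₂ .inl i * horPoly₂ .inr j - horPoly₂ .inl j * horPoly₂ .inr i)) ^ 2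

/-- The square of `v₁ ⬝ᵥ w₂ - v₂ ⬝ᵥ w₁`, as a polynomial. -/
noncomputable def verticalPoly : MvPolynomial (Fin 11 ⊕ Fin 11) ℝ :=
  (horPoly₁ .inl ⬝ᵥ horPoly₂ .inr - horPoly₂ .inl ⬝ᵥ horPoly₁ .inr) ^ 2

/-- The contribution to the curvature of the components along the fibre, as a polynomial. -/
noncomputable def fibrePoly : MvPolynomial (Fin 11 ⊕ Fin 11) ℝ :=
  ∑ i, (.X (.inl 2) * horPoly₁ .inr i - .X (.inr 2) * horPoly₁ .inl i) ^ 2 +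
    ∑ i, (.X (.inl 2) * horPoly₂ .inr i - .X (.inr 2) * horPoly₂ .inl i) ^ 2

/-- Normalizing the fibre coordinate turns the factor `9r²/4` of the fibre term into `3r/4`, which
is what makes the dependence on `r` affine. -/
theorem curv_orthoCoords {r : ℝ} (hr : 0 < r) (x y : Fin 11 → ℝ) :
    curv 11 stiefel (metric r) basePoint (baseVec (orthoCoords r x)) (baseVec (orthoCoords r y)) =
      MvPolynomial.eval (Sum.elim x y) (wedgePoly + verticalPoly +
        .C r * (.C (3 / 4) * fibrePoly - .C (9 / 4) * verticalPoly)) := by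
  have hx := eval_horPoly₁ r Sum.inl (Sum.elim x y)
  have hy := eval_horPoly₁ r Sum.inr (Sum.elim x y)
  have hx' := eval_horPoly₂ r Sum.inl (Sum.elim x y)
  have hy' := eval_horPoly₂ r Sum.inr (Sum.elim x y)
  rw [Sum.elim_comp_inl] at hx hx'
  rw [Sum.elim_comp_inr] at hy hy'
  -- Here `-(√3 / 3) / √r` is the factor between the fibre component and its orthonormal coordinate.
  have hk : r * (-(√3 / 3) / √r) ^ 2 = 1 / 3 := by
    rw [div_pow, neg_sq, div_pow, Real.sq_sqrt hr.le, Real.sq_sqrt (by norm_num)]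
    field_simp
  rw [curv_eq hr basePoint_mem (baseVec_mem _) (baseVec_mem _), hx, hy, hx', hy',
    fib_orthoCoords, fib_orthoCoords]
  generalize -(√3 / 3) / √r = k at hk
  have hf : ∀ p q : Fin 8 → ℝ,
      9 / 4 * r ^ 2 * (((k * x 2) • q - (k * y 2) • p) ⬝ᵥ ((k * x 2) • q - (k * y 2) • p)) =
        r * (3 / 4 * ∑ i, (x 2 * q i - y 2 * p i) ^ 2) := by
    intro p q
    simp only [dotProduct, Finset.mul_sum]
    refine Finset.sum_congr rfl fun i _ => ?_
    simp only [Pi.sub_apply, Pi.smul_apply, smul_eq_mul]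
    linear_combination 9 / 4 * r * (x 2 * q i - y 2 * p i) ^ 2 * hk
  rw [quartic, mul_add (9 / 4 * r ^ 2), hf, hf]
  simp only [wedgePoly, verticalPoly, fibrePoly, wedge, map_add, map_sub, map_mul, map_pow,
    map_sum, MvPolynomial.eval_C, MvPolynomial.eval_X, Sum.elim_inl, Sum.elim_inr, dotProduct]
  ring

theorem isSumSq_C_mul {τ : Type*} {s : ℝ} (hs : 0 ≤ s) {p : MvPolynomial τ ℝ} (hp : IsSumSq p) :
    IsSumSq (MvPolynomial.C s * p) := by
  refine IsSumSq.mul (IsSquare.isSumSq ⟨MvPolynomial.C √s, ?_⟩) hp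
  rw [← map_mul, Real.mul_self_sqrt hs]

theorem isSumSq_wedgePoly : IsSumSq wedgePoly :=
  isSumSq_C_mul (by norm_num) (IsSumSq.sum fun _ _ => IsSumSq.sum_sq _ _)

theorem isSumSq_verticalPoly : IsSumSq verticalPoly :=
  (IsSquare.sq _).isSumSq

theorem isSumSq_fibrePoly : IsSumSq fibrePoly :=
  (IsSumSq.sum_sq _ _).add (IsSumSq.sum_sq _ _)

theorem nonnegSectionalCurvature_iff {r : ℝ} (hr : 0 < r) :
    NonnegSectionalCurvature 11 stiefel (metric r) ↔ r ≤ 4 / 9 := by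
  constructor
  · intro h
    have h1 := h basePoint basePoint_mem (baseVec (Pi.single 0 1)) (baseVec (Pi.single 1 1))
      ((isTangent_iff basePoint_mem).mpr (baseVec_mem _))
      ((isTangent_iff basePoint_mem).mpr (baseVec_mem _)) (by
        rw [LinearIndependent.pair_iff]
        intro s t hst
        rw [baseVec_eq, baseVec_eq] at hst
        have h2 := congrFun (congrArg Prod.fst hst) 3
        have h3 := congrFun (congrArg Prod.snd hst) 3
        simp at h2 h3
        exact ⟨h3, h2⟩)
    rw [sectionalCurvature_base hr] at h1
    linarith
  · intro h q hq V W hV hW _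
    rw [isTangent_iff hq] at hV hW
    rw [sectionalCurvature, curv_eq hr hq hV hW]
    exact div_nonneg (quartic_nonneg h _ _ _ _ _ _) (metric_cauchy_schwarz hr hq hV hW)

end StiefelG2

theorem mainTheorem5 :
    (∀ r : ℝ, 0 < r →
      (RiemannianCoords.NonnegSectionalCurvature 11 StiefelG2.stiefel (StiefelG2.metric r) ↔
        r ≤ 4 / 9)) ∧
    (∀ r : ℝ, 0 < r →
      RiemannianCoords.sectionalCurvature 11 StiefelG2.stiefel (StiefelG2.metric r)
        StiefelG2.basePoint (StiefelG2.baseVec (Pi.single 0 1))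
        (StiefelG2.baseVec (Pi.single 1 1)) = 1 - 9 * r / 4) ∧
    (∃ P Q : MvPolynomial (Fin 11 ⊕ Fin 11) ℝ,
      (∀ r : ℝ, 0 < r → ∀ x y : Fin 11 → ℝ,
        RiemannianCoords.curv 11 StiefelG2.stiefel (StiefelG2.metric r) StiefelG2.basePoint
            (StiefelG2.baseVec (StiefelG2.orthoCoords r x))
            (StiefelG2.baseVec (StiefelG2.orthoCoords r y)) =
          MvPolynomial.eval (Sum.elim x y) (P + MvPolynomial.C r * Q)) ∧
      IsSumSq P ∧ IsSumSq (P + MvPolynomial.C (4 / 9) * Q)) := by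
  refine ⟨fun r hr => StiefelG2.nonnegSectionalCurvature_iff hr,
    fun r hr => StiefelG2.sectionalCurvature_base hr,
    StiefelG2.wedgePoly + StiefelG2.verticalPoly,
    .C (3 / 4) * StiefelG2.fibrePoly - .C (9 / 4) * StiefelG2.verticalPoly,
    ?_,
    StiefelG2.isSumSq_wedgePoly.add StiefelG2.isSumSq_verticalPoly, ?_⟩
  · intro r hr x y
    rw [StiefelG2.curv_orthoCoords hr x y]
  -- At `r = 4/9` the coefficient `1 - 9r/4` of the vertical square vanishes, and the fibre
  -- coefficient `3r/4` becomes `1/3`.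
  have h : StiefelG2.wedgePoly + StiefelG2.verticalPoly + MvPolynomial.C (4 / 9) *
      (.C (3 / 4) * StiefelG2.fibrePoly - .C (9 / 4) * StiefelG2.verticalPoly) =
      StiefelG2.wedgePoly + .C (1 / 3) * StiefelG2.fibrePoly := by
    rw [mul_sub, ← mul_assoc, ← mul_assoc, ← map_mul, ← map_mul,
      show (4 / 9 * (9 / 4) : ℝ) = 1 by norm_num, show (4 / 9 * (3 / 4) : ℝ) = 1 / 3 by norm_num,
      map_one]
    ring
  rw [h]
  exact StiefelG2.isSumSq_wedgePoly.add
    (StiefelG2.isSumSq_C_mul (by norm_num) StiefelG2.isSumSq_fibrePoly)
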